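/- Let $m\ge 1$ be an integer and let $p=(p_0,\dots,p_m)$ be a strictly positive probability vector. The random noble means substitution $\zeta_m$ on the alphabet $\mathcal A=\{a,b\}$ maps $b\mapsto a$ and, for $0\le i\le m$, maps $a\mapsto a^{i}ba^{m-i}$ with probability $p_i$; it acts on words by applying it independently to each letter. A finite word is legal if, for some $k\ge 1$, it is a (contiguous) subword of a realisation of $\zeta_m^k(b)$; let $\mathcal D_{m,\ell}$ be the set of legal words of length $\ell$. Let $S$ be the shift on $\mathcal A^{\mathbb Z}$, $(Sx)_i=x_{i+1}$, and let the hull $\mathbb X_m\subset\mathcal A^{\mathbb Z}$ be the smallest closed shift-invariant set that contains all $x\in\mathcal A^{\mathbb Z}$ which are accumulation points of (realisations of) the sequence $(\zeta_m^k(a|a))_{k\ge 0}$, where $|$ marks the boundary between the positions $-1$ and $0$. For $\ell\ge 1$ let $M_{m,\ell}$ be the matrix of the induced substitution on $\mathcal D_{m,\ell}$: for $u,w=w_0\cdots w_{\ell-1}\in\mathcal D_{m,\ell}$, the entry $(M_{m,\ell})_{u,w}$ is the expected number of positions $0\le i<|\zeta_m(w_0)|$ with $v_{[i,i+\ell-1]}=u$,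 where $v=\zeta_m(w)=\zeta_m(w_0)\cdots\zeta_m(w_{\ell-1})$ is the random image of $w$. Let $\boldsymbol R_{m,\ell}$ be its right Perron–Frobenius eigenvector, normalised so that its entries sum to $1$. There is exactly one Borel measure $\mu_m$ on $\mathbb X_m$ such that $$\mu_m\bigl(\{v\in\mathbb X_m : v_{[k,k+\ell-1]}=w\}\bigr)=\boldsymbol R_{m,\ell}(w)\qquad\text{for all } k\in\mathbb Z,\ \ell\ge 1,\ w\in\mathcal D_{m,\ell},$$ and $\mu_m$ is a shift-invariant probability measure. For every $f\in L^1(\mathbb X_m,\mu_m)$ and every fixed $s\in\mathbb Z$, $$\lim_{N\to\infty}\frac1N\sum_{i=s}^{N+s-1}f(S^ix)=\int_{\mathbb X_m}f\,\mathrm d\mu_m$$ for $\mu_m$-almost every $x\in\mathbb X_m$. In particular, $\mu_m$ is ergodic for $S$. -/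

import Mathlib

open MeasureTheory Filter Topology

noncomputable section

namespace RNMS

/-- The binary alphabet. -/
inductive Letter : Type where
  | a : Letter
  | b : Letter
  deriving DecidableEq

instance : Fintype Letter where
  elems := {Letter.a, Letter.b}
  complete x := by cases x <;> simp

/-- The alphabet carries the discrete topology. -/
instance : TopologicalSpace Letter := ⊥

instance : DiscreteTopology Letter := ⟨rfl⟩

/-- The alphabet carries the discrete σ-algebra. -/
instance : MeasurableSpace Letter := ⊤

instance : DiscreteMeasurableSpace Letter := ⟨fun _ => trivial⟩

/-! ### The random noble means substitution -/

/-- The noble means substitution `ζ_{m,i}`, `0 ≤ i ≤ m`:  `a ↦ aⁱ b aᵐ⁻ⁱ`, `b ↦ a`. -/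
def nms (m : ℕ) (i : Fin (m + 1)) : Letter → List Letter
  | Letter.a =>
      List.replicate (i : ℕ) Letter.a ++ Letter.b :: List.replicate (m - (i : ℕ)) Letter.a
  | Letter.b => [Letter.a]

/-- The list of the images of the letters of `w` when `ζ_{m, c j}` is applied to the `j`-th letter.
In the random substitution the choices `c j` are independent with law `p`, so that `c` has
probability `∏ j, p (c j)`. -/
def letterImages (m : ℕ) {ℓ : ℕ} (w : Fin ℓ → Letter) (c : Fin ℓ → Fin (m + 1)) :
    List (List Letter) :=
  List.ofFn fun j => nms m (c j) (w j)

/-- `v` is a realisation of `ζ_m(w)`. (For a strictly positive probability vector, every choice has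
positive probability.) -/
def IsImage (m : ℕ) (w v : List Letter) : Prop :=
  ∃ c : Fin w.length → Fin (m + 1), v = (letterImages m w.get c).flatten

/-- `v` is a realisation of `ζ_m^k(w)`. -/
def IsIterImage (m : ℕ) : ℕ → List Letter → List Letter → Prop
  | 0, w, v => v = w
  | k + 1, w, v => ∃ u, IsIterImage m k w u ∧ IsImage m u v

/-- `w` is `ζ_m`-legal: for some `k ≥ 1` it is a (contiguous) subword of a realisation of
`ζ_m^k(b)`. -/
def IsLegal (m : ℕ) (w : List Letter) : Prop :=
  ∃ k, 1 ≤ k ∧ ∃ v, IsIterImage m k [Letter.b] v ∧ w <:+: v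

/-- The set `D_{m,ℓ}` of legal words of length `ℓ`. -/
abbrev LegalWord (m ℓ : ℕ) : Type := {w : Fin ℓ → Letter // IsLegal m (List.ofFn w)}

instance (m ℓ : ℕ) : Fintype (LegalWord m ℓ) := Fintype.ofFinite _

/-! ### The hull -/

/-- The two-sided sequence `x` agrees on `[-n, n - 1]` with the marked finite word `u|v`, in which
`v` starts at position `0` and `u` ends at position `-1`; in particular `u` and `v` have length at
least `n`. -/
def AgreesOn (n : ℕ) (x : ℤ → Letter) (u v : List Letter) : Prop :=
  ∀ j : ℕ, j < n → v[j]? = some (x j) ∧ u.reverse[j]? = some (x (-(j + 1)))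

/-- The accumulation points, in the local topology, of (the realisations of)
`ζ_m^k(a|a)`, `k ≥ 0`. -/
def accPoints (m : ℕ) : Set (ℤ → Letter) :=
  {x | ∀ n K : ℕ, ∃ k, K ≤ k ∧ ∃ u v, IsIterImage m k [Letter.a] u ∧
    IsIterImage m k [Letter.a] v ∧ AgreesOn n x u v}

/-- The shift on the full two-sided shift space, `(S x)_i = x_{i+1}`. -/
def shift : Equiv.Perm (ℤ → Letter) where
  toFun x i := x (i + 1)
  invFun x i := x (i - 1)
  left_inv x := by funext i; simp
  right_inv x := by funext i; simp

/-- The hull `𝕏_m`: the smallest closed shift-invariant set containing `accPoints m`. -/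
def hull (m : ℕ) : Set (ℤ → Letter) :=
  ⋂₀ {Y | IsClosed Y ∧ shift ⁻¹' Y = Y ∧ accPoints m ⊆ Y}

theorem shift_mem_hull (m : ℕ) (x : ℤ → Letter) : shift x ∈ hull m ↔ x ∈ hull m := by
  simp only [hull, Set.mem_sInter]
  refine forall₂_congr fun Y hY => ?_
  rw [← Set.mem_preimage, hY.2.1]

/-- The shift on the hull. -/
def hullShift (m : ℕ) : Equiv.Perm (hull m) :=
  shift.subtypePerm (shift_mem_hull m)

/-- The cylinder set `Z_k(w) = {v ∈ 𝕏_m | v_{[k, k+ℓ-1]} = w}`. -/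
def cylinder (m : ℕ) {ℓ : ℕ} (k : ℤ) (w : Fin ℓ → Letter) : Set (hull m) :=
  {v | ∀ j : Fin ℓ, (v : ℤ → Letter) (k + (j : ℕ)) = w j}

/-! ### The induced substitution and the measure -/

/-- The image of the legal word `w = w_0 ⋯ w_{ℓ-1}` under the induced substitution for the choices
`c`: with `v = ζ(w_0) ⋯ ζ(w_{ℓ-1})` it is the word
`v_{[0,ℓ-1]} v_{[1,ℓ]} ⋯ v_{[r-1,r+ℓ-2]}`, where `r = |ζ(w_0)|`, over the words of length `ℓ`. -/
def inducedImage (m : ℕ) {ℓ : ℕ} (w : Fin ℓ → Letter) (c : Fin ℓ → Fin (m + 1)) :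
    List (List Letter) :=
  (List.range ((letterImages m w c).headD []).length).map fun i =>
    ((letterImages m w c).flatten.drop i).take ℓ

/-- The induced substitution matrix `M_{m,ℓ}`: the entry `(u, w)` is the expected number of
occurrences of the letter `u` in the image of the letter `w` under the induced substitution. -/
def inducedMatrix (m : ℕ) (p : Fin (m + 1) → ℝ) (ℓ : ℕ) :
    Matrix (LegalWord m ℓ) (LegalWord m ℓ) ℝ :=
  fun u w => ∑ c : Fin ℓ → Fin (m + 1),
    (∏ j, p (c j)) * ((inducedImage m w.1 c).count (List.ofFn u.1) : ℝ)

/-- `R` is the statistically normalised right Perron–Frobenius eigenvector of `M`: its entries are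
positive with sum `1`, and it is a right eigenvector of `M` for an eigenvalue `r` that bounds the
modulus of every complex eigenvalue of `M`. -/
def IsRightPF {ι : Type*} [Fintype ι] (M : Matrix ι ι ℝ) (R : ι → ℝ) : Prop :=
  (∀ i, 0 < R i) ∧ ∑ i, R i = 1 ∧
    ∃ r : ℝ, M.mulVec R = r • R ∧
      ∀ (z : ℂ) (x : ι → ℂ), x ≠ 0 → (M.map Complex.ofReal).mulVec x = z • x → ‖z‖ ≤ r

/-- `μ` takes on all cylinder sets the values `μ(Z_k(w)) = R_{m,ℓ}(w)`, where `ℓ ≥ 1`, `w` is a legal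
word of length `ℓ`, `k ∈ ℤ` and `R_{m,ℓ}` is the right Perron–Frobenius eigenvector of
`M_{m,ℓ}`. -/
def HasPFCylinders (m : ℕ) (p : Fin (m + 1) → ℝ) (μ : Measure (hull m)) : Prop :=
  ∀ ℓ : ℕ, 1 ≤ ℓ → ∃ R : LegalWord m ℓ → ℝ, IsRightPF (inducedMatrix m p ℓ) R ∧
    ∀ (k : ℤ) (w : LegalWord m ℓ), μ (cylinder m k w.1) = ENNReal.ofReal (R w)

end RNMS

end

noncomputable section

namespace RNMS

/-! ### Realisations of the random substitution -/

section Realisations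

variable {m : ℕ}

/-! All realisations of `ζ_m^k(a)` have the same length `L_k`. Let `E_k(u)` be the expected number
of occurrences of `u` in `ζ_m^k(a)`. The image of `a` consists of `m` letters `a` and one `b`, and
`b ↦ a`; hence `E_{k+2} = m E_{k+1} + E_k + e_k`, where `e_k ≥ 0` is bounded because only
occurrences across the seams are missed. With `λ² = mλ + 1` the sequence `E_k / λ^k` converges, with
positive limit if `u` is legal, so `freq p u = lim E_k(u) / L_k` exists.

The adjoint of the substitution acts on functions of words: `expect_tailSum` moves `ζ_m` from the
word to the summed function, and on local functions this operator, `induce`, is multiplication by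
the induced matrix (`induce_eq_sum`). Hence the frequencies form a positive eigenvector with
eigenvalue `λ`. For any other Perron–Frobenius eigenvector the same duality gives `λ^k R(u)` as an
`R`-weighted mean of `induce^k` of an indicator. That function is asymptotic to a constant depending
on the first letter only, times `L_k * freq p u`; thus `R` is proportional to `freq`
(`IsRightPF.eq_freq`).

The measure is an ultrafilter limit of mean Birkhoff averages along hull points whose right halves
begin with realisations of `ζ_m^n(a)` (`exists_invariant_measure`). Central cylinders form a
generating π-system, which gives uniqueness.

Ergodicity is a law of large numbers. A long window is, up to its ends, a concatenation of
independent level-`k` blocks, so the count of `u` has variance linear in the window length for fixed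
`k`, and a bias that is relatively small for large `k` (`exists_block_sum`, `exists_sum_sq_le`).
Visit frequencies to cylinders therefore converge in mean square. This property passes to all
measurable sets by a Dynkin argument, and for an invariant set of measure `c` it forces `c (1 - c) =
0` (`ergodic_of_hasMeanFreq`). A maximal-function argument then yields the pointwise averages. -/

theorem isImage_nil {v : List Letter} : IsImage m [] v ↔ v = [] := by
  constructor
  · rintro ⟨c, rfl⟩
    simp [letterImages]
  · rintro rfl
    exact ⟨fun _ => 0, by simp [letterImages]⟩

theorem letterImages_cons (x : Letter) (w : List Letter)
    (c : Fin (w.length + 1) → Fin (m + 1)) :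
    letterImages m (x :: w).get c = nms m (c 0) x :: letterImages m w.get (fun j => c j.succ) := by
  unfold letterImages
  exact List.ofFn_succ

theorem isImage_cons {x : Letter} {w v : List Letter} :
    IsImage m (x :: w) v ↔ ∃ i v', IsImage m w v' ∧ v = nms m i x ++ v' := by
  constructor
  · rintro ⟨c, rfl⟩
    refine ⟨c 0, _, ⟨fun j => c j.succ, rfl⟩, ?_⟩
    rw [letterImages_cons x w c]
    rfl
  · rintro ⟨i, v', ⟨c, rfl⟩, rfl⟩
    refine ⟨(Fin.cons i c : Fin (w.length + 1) → Fin (m + 1)), ?_⟩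
    rw [letterImages_cons x w]
    simp

theorem isImage_append {w₁ w₂ v : List Letter} :
    IsImage m (w₁ ++ w₂) v ↔ ∃ v₁ v₂, IsImage m w₁ v₁ ∧ IsImage m w₂ v₂ ∧ v = v₁ ++ v₂ := by
  induction w₁ generalizing v with
  | nil => simp [isImage_nil]
  | cons x w₁ ih =>
    simp only [List.cons_append, isImage_cons, ih]
    constructor
    · rintro ⟨i, _, ⟨v₁, v₂, h₁, h₂, rfl⟩, rfl⟩
      exact ⟨_, v₂, ⟨i, v₁, h₁, rfl⟩, h₂, by simp⟩
    · rintro ⟨_, v₂, ⟨i, v₁, h₁, rfl⟩, h₂, rfl⟩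
      exact ⟨i, _, ⟨v₁, v₂, h₁, h₂, rfl⟩, by simp⟩

theorem isIterImage_one {w v : List Letter} : IsIterImage m 1 w v ↔ IsImage m w v := by
  simp [IsIterImage]

theorem isIterImage_add {j k : ℕ} {w v : List Letter} :
    IsIterImage m (j + k) w v ↔ ∃ u, IsIterImage m j w u ∧ IsIterImage m k u v := by
  induction k generalizing v with
  | zero => simp [IsIterImage]
  | succ k ih =>
    rw [← Nat.add_assoc]
    simp only [IsIterImage, ih]
    constructor
    · rintro ⟨u, ⟨u', h₁, h₂⟩, h⟩
      exact ⟨u', h₁, u, h₂, h⟩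
    · rintro ⟨u', h₁, u, h₂, h⟩
      exact ⟨u, ⟨u', h₁, h₂⟩, h⟩

theorem isIterImage_append {k : ℕ} {w₁ w₂ v : List Letter} :
    IsIterImage m k (w₁ ++ w₂) v ↔
      ∃ v₁ v₂, IsIterImage m k w₁ v₁ ∧ IsIterImage m k w₂ v₂ ∧ v = v₁ ++ v₂ := by
  induction k generalizing v with
  | zero => simp [IsIterImage]
  | succ k ih =>
    simp only [IsIterImage, ih]
    constructor
    · rintro ⟨_, ⟨u₁, u₂, h₁, h₂, rfl⟩, h⟩
      obtain ⟨v₁, v₂, h₁', h₂', rfl⟩ := isImage_append.1 h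
      exact ⟨v₁, v₂, ⟨u₁, h₁, h₁'⟩, ⟨u₂, h₂, h₂'⟩, rfl⟩
    · rintro ⟨v₁, v₂, ⟨u₁, h₁, h₁'⟩, ⟨u₂, h₂, h₂'⟩, rfl⟩
      exact ⟨_, ⟨u₁, u₂, h₁, h₂, rfl⟩, isImage_append.2 ⟨v₁, v₂, h₁', h₂', rfl⟩⟩

theorem exists_isImage (w : List Letter) : ∃ v, IsImage m w v := ⟨_, fun _ => 0, rfl⟩

theorem exists_isIterImage (k : ℕ) (w : List Letter) : ∃ v, IsIterImage m k w v := by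
  induction k with
  | zero => exact ⟨w, rfl⟩
  | succ k ih =>
    obtain ⟨u, hu⟩ := ih
    obtain ⟨v, hv⟩ := exists_isImage (m := m) u
    exact ⟨v, u, hu, hv⟩

theorem isIterImage_nil {k : ℕ} {v : List Letter} : IsIterImage m k [] v ↔ v = [] := by
  induction k generalizing v with
  | zero => rfl
  | succ k ih => simp [IsIterImage, ih, isImage_nil]

theorem isImage_b {v : List Letter} : IsImage m [Letter.b] v ↔ v = [Letter.a] := by
  simp [isImage_cons, isImage_nil, nms]

theorem isIterImage_succ_b {k : ℕ} {v : List Letter} :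
    IsIterImage m (k + 1) [Letter.b] v ↔ IsIterImage m k [Letter.a] v := by
  rw [Nat.add_comm, isIterImage_add]
  simp [isIterImage_one, isImage_b]

/-- The length of every realisation of `ζ_m^k` on a letter. -/
def imageLen (m : ℕ) : ℕ → Letter → ℕ
  | 0, _ => 1
  | k + 1, Letter.a => m * imageLen m k Letter.a + imageLen m k Letter.b
  | k + 1, Letter.b => imageLen m k Letter.a

/-- The length of every realisation of `ζ_m^k` on a word. -/
def wordLen (m k : ℕ) (w : List Letter) : ℕ := (w.map (imageLen m k)).sum

@[simp] theorem wordLen_nil (k : ℕ) : wordLen m k [] = 0 := rfl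

@[simp] theorem wordLen_cons (k : ℕ) (x : Letter) (w : List Letter) :
    wordLen m k (x :: w) = imageLen m k x + wordLen m k w := by simp [wordLen]

@[simp] theorem wordLen_append (k : ℕ) (v w : List Letter) :
    wordLen m k (v ++ w) = wordLen m k v + wordLen m k w := by simp [wordLen]

@[simp] theorem wordLen_zero (w : List Letter) : wordLen m 0 w = w.length := by
  induction w with
  | nil => rfl
  | cons x w ih => simp [ih, imageLen, Nat.add_comm]

/-- All choices `i` give images with the same letter counts, which is why lengths are deterministic.
-/
theorem wordLen_nms (k : ℕ) (i : Fin (m + 1)) (x : Letter) :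
    wordLen m k (nms m i x) = imageLen m (k + 1) x := by
  cases x with
  | a =>
    have hi : (i : ℕ) + (m - i) = m := by omega
    simp only [nms, wordLen_append, wordLen_cons, imageLen]
    simp only [wordLen, List.map_replicate, List.sum_replicate, smul_eq_mul]
    calc (i : ℕ) * imageLen m k Letter.a +
          (imageLen m k Letter.b + (m - i : ℕ) * imageLen m k Letter.a)
        = ((i : ℕ) + (m - i)) * imageLen m k Letter.a + imageLen m k Letter.b := by ring
      _ = _ := by rw [hi]
  | b => simp [nms, imageLen]

theorem IsImage.wordLen_eq {k : ℕ} {w v : List Letter} (h : IsImage m w v) :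
    wordLen m k v = wordLen m (k + 1) w := by
  induction w generalizing v with
  | nil => simp [isImage_nil.1 h]
  | cons x w ih =>
    obtain ⟨i, v', h', rfl⟩ := isImage_cons.1 h
    simp [ih h', wordLen_nms]

theorem IsIterImage.wordLen_eq {j k : ℕ} {w v : List Letter} (h : IsIterImage m j w v) :
    wordLen m k v = wordLen m (j + k) w := by
  induction j generalizing v k with
  | zero => simp [show v = w from h]
  | succ j ih =>
    obtain ⟨u, hu, huv⟩ := h
    rw [huv.wordLen_eq, ih hu]
    congr 1
    omega

theorem IsIterImage.length_eq {k : ℕ} {w v : List Letter} (h : IsIterImage m k w v) :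
    v.length = wordLen m k w := by
  rw [← wordLen_zero (m := m), h.wordLen_eq]
  rfl

theorem imageLen_pos (k : ℕ) (x : Letter) : 0 < imageLen m k x := by
  induction k generalizing x with
  | zero => simp [imageLen]
  | succ k ih =>
    cases x with
    | a => exact Nat.add_pos_right _ (ih _)
    | b => exact ih _

theorem length_le_wordLen (k : ℕ) (w : List Letter) : w.length ≤ wordLen m k w := by
  induction w with
  | nil => simp
  | cons x w ih =>
    have := imageLen_pos (m := m) k x
    simp only [List.length_cons, wordLen_cons]
    omega

theorem imageLen_le_a (hm : 1 ≤ m) (k : ℕ) (x : Letter) :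
    imageLen m k x ≤ imageLen m k Letter.a := by
  cases x with
  | a => rfl
  | b =>
    cases k with
    | zero => simp [imageLen]
    | succ k =>
      simp only [imageLen]
      exact le_trans (Nat.le_mul_of_pos_left _ hm) (Nat.le_add_right _ _)

theorem lt_imageLen_a (hm : 1 ≤ m) (k : ℕ) : k < imageLen m k Letter.a := by
  induction k with
  | zero => simp [imageLen]
  | succ k ih =>
    simp only [imageLen]
    have h1 : imageLen m k Letter.a ≤ m * imageLen m k Letter.a := Nat.le_mul_of_pos_left _ hm
    have := imageLen_pos (m := m) k Letter.b
    omega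

theorem le_imageLen (hm : 1 ≤ m) (k : ℕ) (x : Letter) : k ≤ imageLen m k x := by
  cases x with
  | a => exact (lt_imageLen_a hm k).le
  | b =>
    cases k with
    | zero => simp
    | succ k => exact lt_imageLen_a hm k

end Realisations

/-! ### Legal words -/

section Legal

variable {m : ℕ}

theorem IsLegal.infix {v w : List Letter} (h : IsLegal m v) (hw : w <:+: v) : IsLegal m w := by
  obtain ⟨k, hk, u, hu, hv⟩ := h
  exact ⟨k, hk, u, hu, hw.trans hv⟩

theorem IsIterImage.isLegal {k : ℕ} {v : List Letter} (h : IsIterImage m k [Letter.a] v) :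
    IsLegal m v :=
  ⟨k + 1, by omega, v, isIterImage_succ_b.2 h, List.infix_rfl⟩

theorem IsLegal.isIterImage {k : ℕ} {v w : List Letter} (hw : IsLegal m w)
    (h : IsIterImage m k w v) : IsLegal m v := by
  obtain ⟨j, hj, _, hu, s, t, rfl⟩ := hw
  obtain ⟨s', hs⟩ := exists_isIterImage (m := m) k s
  obtain ⟨t', ht⟩ := exists_isIterImage (m := m) k t
  refine ⟨j + k, by omega, s' ++ v ++ t', isIterImage_add.2 ⟨_, hu, ?_⟩, s', t', rfl⟩
  exact isIterImage_append.2 ⟨_, _, isIterImage_append.2 ⟨_, _, hs, h, rfl⟩, ht, rfl⟩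

theorem isImage_a (i : Fin (m + 1)) : IsImage m [Letter.a] (nms m i Letter.a) :=
  isImage_cons.2 ⟨i, [], isImage_nil.2 rfl, by simp⟩

theorem nms_last_a : nms m (Fin.last m) Letter.a = List.replicate m Letter.a ++ [Letter.b] := by
  simp [nms]

theorem nms_zero_a : nms m 0 Letter.a = Letter.b :: List.replicate m Letter.a := by
  simp [nms]

/-- From `a ↦ b a ⋯` one gets `b a ↦ a · aᵐ b`, which begins with `aa`. This makes the seed `a|a` of
the hull legal. -/
theorem isLegal_aa (hm : 1 ≤ m) : IsLegal m [Letter.a, Letter.a] := by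
  obtain ⟨n, rfl⟩ : ∃ n, m = n + 1 := ⟨m - 1, by omega⟩
  obtain ⟨r, hr⟩ := exists_isImage (m := n + 1) (List.replicate n Letter.a)
  have h₁ : IsIterImage (n + 1) 1 [Letter.a] (Letter.b :: Letter.a :: List.replicate n Letter.a) :=
    isIterImage_one.2 (by simpa [nms_zero_a, List.replicate_succ] using isImage_a (m := n + 1) 0)
  have h₂ : IsIterImage (n + 1) 2 [Letter.a]
      (Letter.a :: (nms (n + 1) (Fin.last _) Letter.a ++ r)) :=
    ⟨_, h₁, isImage_cons.2 ⟨0, _, isImage_cons.2 ⟨Fin.last _, r, hr, rfl⟩, rfl⟩⟩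
  refine h₂.isLegal.infix ⟨[], List.replicate n Letter.a ++ [Letter.b] ++ r, ?_⟩
  simp [nms_last_a, List.replicate_succ]

/-- A realisation of `ζ_m^k(a)` is a prefix of a realisation of `ζ_m^n(a)` for all `n ≥ k`. -/
theorem IsIterImage.exists_prefix (hm : 1 ≤ m) {k : ℕ} {v : List Letter}
    (h : IsIterImage m k [Letter.a] v) (n : ℕ) :
    ∃ u, IsIterImage m (n + k) [Letter.a] u ∧ v <+: u := by
  induction n with
  | zero => exact ⟨v, by simpa using h, List.prefix_rfl⟩
  | succ n ih =>
    obtain ⟨u, hu, huv⟩ := ih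
    obtain ⟨r, rfl⟩ : ∃ r, m = r + 1 := ⟨m - 1, by omega⟩
    obtain ⟨t, ht⟩ := exists_isIterImage (m := r + 1) (n + k)
      (List.replicate r Letter.a ++ [Letter.b])
    refine ⟨u ++ t, ?_, huv.trans (List.prefix_append _ _)⟩
    rw [show n + 1 + k = 1 + (n + k) by omega, isIterImage_add]
    -- The choice `a ↦ aᵐ b` starts with `a`, so one more level begins with a copy of the previous
    -- realisation.
    refine ⟨_, isIterImage_one.2 (isImage_a (Fin.last _)), ?_⟩
    rw [nms_last_a, List.replicate_succ, List.cons_append]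
    exact isIterImage_append (w₁ := [Letter.a]).2 ⟨u, t, hu, ht, rfl⟩

end Legal

/-! ### Expectations over the realisations -/

section Expect

variable {m : ℕ}

/-- `p` is a strictly positive probability vector. -/
structure IsPosProb (p : Fin (m + 1) → ℝ) : Prop where
  pos : ∀ i, 0 < p i
  sum_eq_one : ∑ i, p i = 1

/-- The expectation of `g` over the realisations of `ζ_m(w)`; its `k`-th iterate is the
expectation over the realisations of `ζ_m^k(w)`. -/
def expect (p : Fin (m + 1) → ℝ) : (List Letter → ℝ) → List Letter → ℝ
  | g, [] => g []
  | g, x :: w => ∑ i, p i * expect p (fun v => g (nms m i x ++ v)) w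

variable {p : Fin (m + 1) → ℝ}

/-- The recursion is a finite convex combination over all realisations, possibly with repetitions.
Linearity, monotonicity and Fubini are then properties of finite sums. -/
theorem expect_repr (P : IsPosProb p) (w : List Letter) :
    ∃ (ι : Type) (_ : Fintype ι) (q : ι → ℝ) (V : ι → List Letter),
      (∀ c, 0 < q c) ∧ ∑ c, q c = 1 ∧ (∀ c, IsImage m w (V c)) ∧
      (∀ v, IsImage m w v → ∃ c, V c = v) ∧ ∀ g, expect p g w = ∑ c, q c * g (V c) := by
  induction w with
  | nil =>
    refine ⟨Unit, inferInstance, fun _ => 1, fun _ => [], by simp, by simp, ?_, ?_, ?_⟩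
    · simp [isImage_nil]
    · simp [isImage_nil]
    · simp [expect]
  | cons x w ih =>
    obtain ⟨ι, _, q, V, hq, hs, hV, hV', hg⟩ := ih
    refine ⟨Fin (m + 1) × ι, inferInstance, fun c => p c.1 * q c.2,
      fun c => nms m c.1 x ++ V c.2, fun c => mul_pos (P.pos _) (hq _), ?_, ?_, ?_, ?_⟩
    · simp [Fintype.sum_prod_type, ← Finset.mul_sum, hs, P.sum_eq_one]
    · exact fun c => isImage_cons.2 ⟨c.1, V c.2, hV _, rfl⟩
    · intro v hv
      obtain ⟨i, v', hv', rfl⟩ := isImage_cons.1 hv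
      obtain ⟨c, rfl⟩ := hV' v' hv'
      exact ⟨(i, c), rfl⟩
    · intro g
      simp only [expect, hg, Fintype.sum_prod_type, Finset.mul_sum, mul_assoc]

/-- The law of the realisations of `ζ_m^k(w)` is a finite probability vector. -/
theorem iterate_expect_repr (P : IsPosProb p) (k : ℕ) (w : List Letter) :
    ∃ (ι : Type) (_ : Fintype ι) (q : ι → ℝ) (V : ι → List Letter),
      (∀ c, 0 < q c) ∧ ∑ c, q c = 1 ∧ (∀ c, IsIterImage m k w (V c)) ∧
      (∀ v, IsIterImage m k w v → ∃ c, V c = v) ∧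
      ∀ g, (expect p)^[k] g w = ∑ c, q c * g (V c) := by
  induction k with
  | zero =>
    refine ⟨Unit, inferInstance, fun _ => 1, fun _ => w, by simp, by simp, ?_, ?_, ?_⟩
    · simp [IsIterImage]
    · simp [IsIterImage]
    · simp
  | succ k ih =>
    obtain ⟨ι, _, q, V, hq, hs, hV, hV', hg⟩ := ih
    choose κ _ r U hr hrs hU hU' hrg using expect_repr P
    refine ⟨Σ c : ι, κ (V c), inferInstance, fun c => q c.1 * r (V c.1) c.2,
      fun c => U (V c.1) c.2, fun c => mul_pos (hq _) (hr _ _), ?_, ?_, ?_, ?_⟩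
    · simp [Fintype.sum_sigma, ← Finset.mul_sum, hs, hrs]
    · exact fun c => ⟨V c.1, hV _, hU _ _⟩
    · rintro v ⟨u, hu, hv⟩
      obtain ⟨c, rfl⟩ := hV' u hu
      obtain ⟨d, rfl⟩ := hU' _ v hv
      exact ⟨⟨c, d⟩, rfl⟩
    · intro g
      simp only [Function.iterate_succ_apply, hg, hrg, Fintype.sum_sigma, Finset.mul_sum,
        mul_assoc]

theorem iterate_expect_mono (P : IsPosProb p) {k : ℕ} {w : List Letter} {g g' : List Letter → ℝ}
    (h : ∀ v, IsIterImage m k w v → g v ≤ g' v) :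
    (expect p)^[k] g w ≤ (expect p)^[k] g' w := by
  obtain ⟨ι, _, q, V, hq, hs, hV, hV', hg⟩ := iterate_expect_repr P k w
  rw [hg, hg]
  exact Finset.sum_le_sum fun c _ => mul_le_mul_of_nonneg_left (h _ (hV c)) (hq c).le

theorem iterate_expect_congr (P : IsPosProb p) {k : ℕ} {w : List Letter} {g g' : List Letter → ℝ}
    (h : ∀ v, IsIterImage m k w v → g v = g' v) :
    (expect p)^[k] g w = (expect p)^[k] g' w :=
  le_antisymm (iterate_expect_mono P fun v hv => (h v hv).le)
    (iterate_expect_mono P fun v hv => (h v hv).ge)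

theorem iterate_expect_add (P : IsPosProb p) (k : ℕ) (w : List Letter) (g g' : List Letter → ℝ) :
    (expect p)^[k] (fun v => g v + g' v) w = (expect p)^[k] g w + (expect p)^[k] g' w := by
  obtain ⟨ι, _, q, V, hq, hs, hV, hV', hg⟩ := iterate_expect_repr P k w
  simp only [hg, mul_add, Finset.sum_add_distrib]

theorem iterate_expect_const_mul (P : IsPosProb p) (k : ℕ) (w : List Letter) (c : ℝ)
    (g : List Letter → ℝ) :
    (expect p)^[k] (fun v => c * g v) w = c * (expect p)^[k] g w := by
  obtain ⟨ι, _, q, V, hq, hs, hV, hV', hg⟩ := iterate_expect_repr P k w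
  simp only [hg, Finset.mul_sum, mul_left_comm]

theorem iterate_expect_sub (P : IsPosProb p) (k : ℕ) (w : List Letter) (g g' : List Letter → ℝ) :
    (expect p)^[k] (fun v => g v - g' v) w = (expect p)^[k] g w - (expect p)^[k] g' w := by
  obtain ⟨ι, _, q, V, hq, hs, hV, hV', hg⟩ := iterate_expect_repr P k w
  simp only [hg, mul_sub, Finset.sum_sub_distrib]

theorem iterate_expect_sum (P : IsPosProb p) (k : ℕ) (w : List Letter) {α : Type*} (s : Finset α)
    (g : α → List Letter → ℝ) :
    (expect p)^[k] (fun v => ∑ a ∈ s, g a v) w = ∑ a ∈ s, (expect p)^[k] (g a) w := by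
  obtain ⟨ι, _, q, V, hq, hs, hV, hV', hg⟩ := iterate_expect_repr P k w
  simp only [hg, Finset.mul_sum]
  rw [Finset.sum_comm]

theorem iterate_expect_const (P : IsPosProb p) (k : ℕ) (w : List Letter) (c : ℝ) :
    (expect p)^[k] (fun _ => c) w = c := by
  obtain ⟨ι, _, q, V, hq, hs, hV, hV', hg⟩ := iterate_expect_repr P k w
  simp [hg, ← Finset.sum_mul, hs]

theorem iterate_expect_eq_const (P : IsPosProb p) {k : ℕ} {w : List Letter} {g : List Letter → ℝ}
    {c : ℝ} (h : ∀ v, IsIterImage m k w v → g v = c) : (expect p)^[k] g w = c :=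
  (iterate_expect_congr P h).trans (iterate_expect_const P k w c)

theorem iterate_expect_nonneg (P : IsPosProb p) {k : ℕ} {w : List Letter} {g : List Letter → ℝ}
    (h : ∀ v, 0 ≤ g v) : 0 ≤ (expect p)^[k] g w :=
  (iterate_expect_const P k w 0).symm.le.trans (iterate_expect_mono P fun v _ => h v)

theorem iterate_expect_le_const (P : IsPosProb p) {k : ℕ} {w : List Letter} {g : List Letter → ℝ}
    {c : ℝ} (h : ∀ v, IsIterImage m k w v → g v ≤ c) : (expect p)^[k] g w ≤ c :=
  (iterate_expect_mono P h).trans (iterate_expect_const P k w c).le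

theorem iterate_expect_pos (P : IsPosProb p) {k : ℕ} {w v : List Letter} {g : List Letter → ℝ}
    (h : ∀ v, 0 ≤ g v) (hv : IsIterImage m k w v) (hgv : 0 < g v) :
    0 < (expect p)^[k] g w := by
  obtain ⟨ι, _, q, V, hq, hs, hV, hV', hg⟩ := iterate_expect_repr P k w
  obtain ⟨c, rfl⟩ := hV' v hv
  rw [hg]
  exact Finset.sum_pos' (fun c _ => mul_nonneg (hq c).le (h _))
    ⟨c, Finset.mem_univ c, mul_pos (hq c) hgv⟩

theorem iterate_expect_comm (P : IsPosProb p) (j k : ℕ) (u w : List Letter)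
    (F : List Letter → List Letter → ℝ) :
    (expect p)^[j] (fun x => (expect p)^[k] (fun y => F x y) w) u =
      (expect p)^[k] (fun y => (expect p)^[j] (fun x => F x y) u) w := by
  obtain ⟨ι, _, q, V, hq, hs, hV, hV', hg⟩ := iterate_expect_repr P j u
  obtain ⟨κ, _, q', V', -, -, -, -, hg'⟩ := iterate_expect_repr P k w
  simp only [hg, hg', Finset.mul_sum]
  rw [Finset.sum_comm]
  simp only [mul_left_comm]

theorem expect_append (w₁ w₂ : List Letter) (g : List Letter → ℝ) :
    expect p g (w₁ ++ w₂) = expect p (fun v₁ => expect p (fun v₂ => g (v₁ ++ v₂)) w₂) w₁ := by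
  induction w₁ generalizing g with
  | nil => simp [expect]
  | cons x w₁ ih => simp [expect, ih]

/-- The images of the two parts of a word are independent. -/
theorem iterate_expect_append (P : IsPosProb p) (k : ℕ) (w₁ w₂ : List Letter)
    (g : List Letter → ℝ) :
    (expect p)^[k] g (w₁ ++ w₂) =
      (expect p)^[k] (fun v₁ => (expect p)^[k] (fun v₂ => g (v₁ ++ v₂)) w₂) w₁ := by
  induction k generalizing w₁ w₂ g with
  | zero => rfl
  | succ k ih =>
    simp only [Function.iterate_succ_apply', expect_append, ih]
    congr 1
    funext v₁
    -- The first step on `w₂` is exchanged with the `k` remaining steps on the image of `w₁`.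
    exact iterate_expect_comm P 1 k w₂ v₁ fun v₂ x₁ => (expect p)^[k] (fun x₂ => g (x₁ ++ x₂)) v₂

theorem iterate_expect_nil (P : IsPosProb p) (k : ℕ) (g : List Letter → ℝ) :
    (expect p)^[k] g [] = g [] :=
  iterate_expect_eq_const P fun v hv => by rw [isIterImage_nil.1 hv]

theorem sum_choices (n : ℕ) (w : Fin n → Letter) (g : List Letter → ℝ) :
    ∑ c : Fin n → Fin (m + 1), (∏ j, p (c j)) * g (letterImages m w c).flatten =
      expect p g (List.ofFn w) := by
  induction n generalizing g with
  | zero => simp [expect, letterImages]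
  | succ n ih =>
    rw [List.ofFn_succ, expect, ← (Fin.consEquiv fun _ => Fin (m + 1)).sum_comp,
      Fintype.sum_prod_type]
    refine Finset.sum_congr rfl fun i _ => ?_
    rw [← ih, Finset.mul_sum]
    refine Finset.sum_congr rfl fun c _ => ?_
    simp [Fin.prod_univ_succ, letterImages, List.ofFn_succ, mul_assoc]

end Expect

/-! ### Sums over the positions in a word -/

section TailSum

/-- The sum of `F` over the nonempty suffixes of a word. -/
def tailSum (F : List Letter → ℝ) : List Letter → ℝ
  | [] => 0
  | x :: v => F (x :: v) + tailSum F v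

theorem tailSum_append (F : List Letter → ℝ) (v₁ v₂ : List Letter) :
    tailSum F (v₁ ++ v₂) = tailSum (fun t => F (t ++ v₂)) v₁ + tailSum F v₂ := by
  induction v₁ with
  | nil => simp [tailSum]
  | cons x v₁ ih => simp [tailSum, ih, add_assoc]

theorem tailSum_mono {F F' : List Letter → ℝ} {v : List Letter}
    (h : ∀ t, t ≠ [] → t <:+ v → F t ≤ F' t) : tailSum F v ≤ tailSum F' v := by
  induction v with
  | nil => exact le_rfl
  | cons x v ih =>
    exact add_le_add (h _ (by simp) List.suffix_rfl)
      (ih fun t ht hv => h t ht (hv.trans (List.suffix_cons x v)))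

theorem tailSum_congr {F F' : List Letter → ℝ} {v : List Letter}
    (h : ∀ t, t ≠ [] → t <:+ v → F t = F' t) : tailSum F v = tailSum F' v :=
  le_antisymm (tailSum_mono fun t ht hv => (h t ht hv).le)
    (tailSum_mono fun t ht hv => (h t ht hv).ge)

theorem tailSum_sum {α : Type*} (s : Finset α) (F : α → List Letter → ℝ) (v : List Letter) :
    tailSum (fun t => ∑ a ∈ s, F a t) v = ∑ a ∈ s, tailSum (F a) v := by
  induction v with
  | nil => simp [tailSum]
  | cons x v ih => simp [tailSum, ih, Finset.sum_add_distrib]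

theorem tailSum_const_mul (c : ℝ) (F : List Letter → ℝ) (v : List Letter) :
    tailSum (fun t => c * F t) v = c * tailSum F v := by
  induction v with
  | nil => simp [tailSum]
  | cons x v ih => simp [tailSum, ih, mul_add]

theorem tailSum_const (c : ℝ) (v : List Letter) :
    tailSum (fun _ => c) v = v.length * c := by
  induction v with
  | nil => simp [tailSum]
  | cons x v ih => simp [tailSum, ih]; ring

theorem tailSum_eq_sum_range (F : List Letter → ℝ) (v : List Letter) :
    tailSum F v = ∑ i ∈ Finset.range v.length, F (v.drop i) := by
  induction v with
  | nil => simp [tailSum]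
  | cons x v ih => simp [tailSum, ih, Finset.sum_range_succ', add_comm]

theorem tailSum_nonneg {F : List Letter → ℝ} (h : ∀ t, 0 ≤ F t) (v : List Letter) :
    0 ≤ tailSum F v := by
  rw [tailSum_eq_sum_range]
  exact Finset.sum_nonneg fun _ _ => h _

/-- The indicator function of the words with prefix `u`. -/
def prefixInd (u t : List Letter) : ℝ := if u <+: t then 1 else 0

/-- The number of occurrences of the nonempty word `u` in a word. -/
def occ (u : List Letter) : List Letter → ℝ := tailSum (prefixInd u)

theorem prefixInd_nonneg (u t : List Letter) : 0 ≤ prefixInd u t := by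
  unfold prefixInd
  split_ifs <;> simp

theorem prefixInd_le_one (u t : List Letter) : prefixInd u t ≤ 1 := by
  unfold prefixInd
  split_ifs <;> simp

theorem prefixInd_append {u s : List Letter} (h : u.length ≤ s.length) (t : List Letter) :
    prefixInd u (s ++ t) = prefixInd u s := by
  unfold prefixInd
  refine if_congr ⟨fun hu => ?_, fun hu => hu.trans (List.prefix_append s t)⟩ rfl rfl
  exact List.prefix_of_prefix_length_le hu (List.prefix_append s t) h

theorem prefixInd_le_append (u s t : List Letter) : prefixInd u s ≤ prefixInd u (s ++ t) := by
  by_cases h : u <+: s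
  · simp [prefixInd, h, h.trans (List.prefix_append s t)]
  · simpa [prefixInd, h] using prefixInd_nonneg u (s ++ t)

theorem occ_nonneg (u v : List Letter) : 0 ≤ occ u v := tailSum_nonneg (prefixInd_nonneg u) v

theorem occ_le_length (u v : List Letter) : occ u v ≤ v.length :=
  (tailSum_mono fun t _ _ => prefixInd_le_one u t).trans (by simp [tailSum_const])

theorem occ_add_le (u v w : List Letter) : occ u v + occ u w ≤ occ u (v ++ w) := by
  rw [occ, tailSum_append]
  exact add_le_add_left (tailSum_mono fun t _ _ => prefixInd_le_append u t w) _

/-- Appending `w` can create occurrences only at the last positions of `v`, fewer than `u.length` of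
them; the minimum makes the induction go through for short `v`. -/
theorem tailSum_prefixInd_append_le (u v w : List Letter) :
    tailSum (fun t => prefixInd u (t ++ w)) v ≤ occ u v + (min v.length u.length : ℕ) := by
  induction v with
  | nil => simp [tailSum, occ]
  | cons x v ih =>
    simp only [occ, tailSum] at ih ⊢
    by_cases h : u.length ≤ (x :: v).length
    · rw [prefixInd_append h]
      have : ((min v.length u.length : ℕ) : ℝ) ≤ (min (x :: v).length u.length : ℕ) := by
        exact_mod_cast min_le_min_right _ (by simp)
      linarith
    · have h' : v.length + 1 ≤ u.length := by simp at h; omega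
      rw [min_eq_left (by omega)] at ih
      rw [List.length_cons, min_eq_left h']
      have h₁ := prefixInd_le_one u (x :: v ++ w)
      have h₂ := prefixInd_nonneg u (x :: v)
      push_cast
      linarith

theorem occ_append_le (u v w : List Letter) :
    occ u (v ++ w) ≤ occ u v + occ u w + u.length := by
  rw [occ, tailSum_append]
  have h₁ := tailSum_prefixInd_append_le u v w
  have h₂ : ((min v.length u.length : ℕ) : ℝ) ≤ u.length := by
    exact_mod_cast min_le_right v.length u.length
  simp only [occ] at *
  linarith

theorem occ_append_le_length (u v w : List Letter) : occ u (v ++ w) ≤ v.length + occ u w := by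
  rw [occ, tailSum_append]
  exact add_le_add_left ((tailSum_mono fun t _ _ => prefixInd_le_one u _).trans
    (by simp [tailSum_const])) _

theorem occ_pos {u v : List Letter} (hu : u ≠ []) (h : u <:+: v) : 0 < occ u v := by
  obtain ⟨s, t, rfl⟩ := h
  rw [List.append_assoc]
  have h₁ := occ_add_le u s (u ++ t)
  have h₂ := occ_nonneg u s
  obtain ⟨x, u', rfl⟩ := List.exists_cons_of_ne_nil hu
  have h₃ : occ (x :: u') (x :: u' ++ t) =
    prefixInd (x :: u') (x :: u' ++ t) + occ (x :: u') (u' ++ t) := rfl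
  have h₄ : prefixInd (x :: u') (x :: u' ++ t) = 1 := if_pos (List.prefix_append _ _)
  have h₅ := occ_nonneg (x :: u') (u' ++ t)
  linarith

end TailSum

/-! ### The induced substitution -/

section Induce

variable {m : ℕ} {p : Fin (m + 1) → ℝ}

/-- The expected sum of `F` over the suffixes that start in the image of the first letter. -/
def induce (p : Fin (m + 1) → ℝ) (F : List Letter → ℝ) : List Letter → ℝ
  | [] => 0
  | x :: z => ∑ i, p i * expect p (fun v => tailSum (fun t => F (t ++ v)) (nms m i x)) z

/-- The positions in the image of `z` are grouped by the letter of `z` whose image contains them.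
This is the adjunction between the substitution and `induce`. -/
theorem expect_tailSum (P : IsPosProb p) (F : List Letter → ℝ) (z : List Letter) :
    expect p (tailSum F) z = tailSum (induce p F) z := by
  induction z with
  | nil => simp [expect, tailSum]
  | cons x z ih =>
    simp only [expect, tailSum, induce, tailSum_append]
    rw [← ih]
    have h : ∀ i : Fin (m + 1), expect p (fun v => tailSum (fun t => F (t ++ v)) (nms m i x) +
        tailSum F v) z = expect p (fun v => tailSum (fun t => F (t ++ v)) (nms m i x)) z +
          expect p (tailSum F) z := fun i => iterate_expect_add P 1 z _ _
    simp only [h, mul_add, Finset.sum_add_distrib, ← Finset.sum_mul, P.sum_eq_one, one_mul]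

theorem iterate_expect_tailSum (P : IsPosProb p) (k : ℕ) (F : List Letter → ℝ) :
    (expect p)^[k] (tailSum F) = tailSum ((induce p)^[k] F) := by
  induction k generalizing F with
  | zero => rfl
  | succ k ih =>
    rw [Function.iterate_succ_apply, Function.iterate_succ_apply, ← ih]
    congr 1
    exact funext (expect_tailSum P F)

theorem iterate_induce_cons (P : IsPosProb p) (k : ℕ) (F : List Letter → ℝ) (x : Letter)
    (z : List Letter) :
    (induce p)^[k] F (x :: z) =
      (expect p)^[k] (tailSum F) (x :: z) - (expect p)^[k] (tailSum F) z := by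
  simp [iterate_expect_tailSum P, tailSum]

/-- The difference in `iterate_induce_cons` keeps exactly the suffixes starting in the level-`k`
image `B` of `x`, which is independent of the image `v` of the rest. -/
theorem iterate_induce_cons' (P : IsPosProb p) (k : ℕ) (F : List Letter → ℝ) (x : Letter)
    (z : List Letter) :
    (induce p)^[k] F (x :: z) = (expect p)^[k] (fun B =>
      (expect p)^[k] (fun v => tailSum (fun t => F (t ++ v)) B) z) [x] := by
  rw [iterate_induce_cons P, ← List.singleton_append, iterate_expect_append P]
  simp only [tailSum_append, iterate_expect_add P, iterate_expect_const P]
  ring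

/-- `F` depends only on the first `n` letters. -/
def IsLocal (n : ℕ) (F : List Letter → ℝ) : Prop :=
  ∀ s t, n ≤ s.length → F (s ++ t) = F s

theorem IsLocal.take {n : ℕ} {F : List Letter → ℝ} (hF : IsLocal n F) {t : List Letter}
    (ht : n ≤ t.length) : F (t.take n) = F t := by
  conv_rhs => rw [← List.take_append_drop n t]
  exact (hF _ _ (by simp [ht])).symm

theorem isLocal_prefixInd (u : List Letter) : IsLocal u.length (prefixInd u) :=
  fun _ t h => prefixInd_append h t

/-- No letter has an empty image: a suffix starting in the image of the first letter has a letter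
there and at least `n - 1` more from the next `n - 1` letters. -/
theorem IsLocal.induce (P : IsPosProb p) {n : ℕ} (hn : 1 ≤ n) {F : List Letter → ℝ}
    (hF : IsLocal n F) : IsLocal n (induce p F) := by
  intro s t hs
  cases s with
  | nil => simp at hs; omega
  | cons x s =>
    simp only [List.cons_append, RNMS.induce]
    refine Finset.sum_congr rfl fun i _ => ?_
    congr 1
    rw [expect_append]
    refine iterate_expect_congr P (k := 1) fun v₁ hv₁ => ?_
    refine iterate_expect_eq_const P (k := 1) fun v₂ _ => ?_
    refine tailSum_congr fun r hr _ => ?_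
    rw [← List.append_assoc]
    refine hF _ _ ?_
    have h₁ := hv₁.length_eq
    have h₂ := length_le_wordLen (m := m) 1 s
    have h₃ := List.length_pos_of_ne_nil hr
    simp at hs ⊢
    omega

theorem IsLocal.iterate_induce (P : IsPosProb p) {n : ℕ} (hn : 1 ≤ n) {F : List Letter → ℝ}
    (hF : IsLocal n F) (k : ℕ) : IsLocal n ((RNMS.induce p)^[k] F) := by
  induction k with
  | zero => exact hF
  | succ k ih =>
    rw [Function.iterate_succ_apply']
    exact ih.induce P hn

theorem induce_congr (P : IsPosProb p) {n : ℕ} {F F' : List Letter → ℝ}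
    (h : ∀ t, IsLegal m t → n ≤ t.length → F t = F' t) {z : List Letter} (hz : IsLegal m z)
    (hn : n ≤ z.length) : induce p F z = induce p F' z := by
  cases z with
  | nil => rfl
  | cons x z =>
    simp only [induce]
    refine Finset.sum_congr rfl fun i _ => ?_
    congr 1
    refine iterate_expect_congr P (k := 1) fun v hv => ?_
    refine tailSum_congr fun r hr hr' => h _ ?_ ?_
    · have : IsImage m (x :: z) (nms m i x ++ v) :=
        isImage_cons.2 ⟨i, v, isIterImage_one.1 hv, rfl⟩
      refine (hz.isIterImage (isIterImage_one.2 this)).infix ?_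
      obtain ⟨s, hs⟩ := hr'
      exact ⟨s, [], by rw [← hs]; simp⟩
    · have h₁ := hv.length_eq
      have h₂ := length_le_wordLen (m := m) 1 z
      have h₃ := List.length_pos_of_ne_nil hr
      simp at hn ⊢
      omega

theorem induce_sum (P : IsPosProb p) {α : Type*} (s : Finset α) (c : α → ℝ)
    (F : α → List Letter → ℝ) (z : List Letter) :
    induce p (fun t => ∑ a ∈ s, c a * F a t) z = ∑ a ∈ s, c a * induce p (F a) z := by
  cases z with
  | nil => simp [induce]
  | cons x z =>
    have h : ∀ i : Fin (m + 1), expect p (fun v => ∑ a ∈ s,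
        c a * tailSum (fun t => F a (t ++ v)) (nms m i x)) z = ∑ a ∈ s,
        c a * expect p (fun v => tailSum (fun t => F a (t ++ v)) (nms m i x)) z := fun i =>
      (iterate_expect_sum P 1 z s _).trans
        (Finset.sum_congr rfl fun a _ => iterate_expect_const_mul P 1 z _ _)
    simp only [induce, tailSum_sum, tailSum_const_mul, h, Finset.mul_sum]
    rw [Finset.sum_comm]
    simp only [mul_left_comm]

theorem count_take_drop (u B r : List Letter) :
    ((((List.range B.length).map fun i => ((B ++ r).drop i).take u.length).count u : ℕ) : ℝ) =
      tailSum (fun t => prefixInd u (t ++ r)) B := by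
  induction B with
  | nil => simp [tailSum]
  | cons x B ih =>
    rw [List.length_cons, List.range_succ_eq_map, List.map_cons, List.map_map, List.count_cons,
      tailSum, ← ih]
    simp only [List.cons_append, List.drop_zero, Nat.cast_add, prefixInd,
      List.prefix_iff_eq_take, beq_iff_eq]
    rw [add_comm]
    congr 1
    rw [Nat.cast_ite]
    exact if_congr eq_comm (by simp) (by simp)

/-- Replaces the sum over choice vectors by `induce`, so that matrix powers are handled by iterating
`induce`. -/
theorem inducedMatrix_apply {ℓ : ℕ} (hℓ : 1 ≤ ℓ) (u w : LegalWord m ℓ) :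
    inducedMatrix m p ℓ u w = induce p (prefixInd (List.ofFn u.1)) (List.ofFn w.1) := by
  obtain ⟨n, rfl⟩ : ∃ n, ℓ = n + 1 := ⟨ℓ - 1, by omega⟩
  obtain ⟨w, hw⟩ := w
  obtain ⟨u, hu⟩ := u
  simp only [inducedMatrix, List.ofFn_succ (f := w), induce]
  rw [← (Fin.consEquiv fun _ => Fin (m + 1)).sum_comp, Fintype.sum_prod_type]
  refine Finset.sum_congr rfl fun i _ => ?_
  rw [← sum_choices, Finset.mul_sum]
  refine Finset.sum_congr rfl fun c _ => ?_
  rw [← count_take_drop]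
  simp [Fin.prod_univ_succ, letterImages, List.ofFn_succ, mul_assoc, inducedImage]

theorem local_eq_sum {ℓ : ℕ} {F : List Letter → ℝ} (hF : IsLocal ℓ F) {t : List Letter}
    (ht : IsLegal m t) (hℓ : ℓ ≤ t.length) :
    F t = ∑ u : LegalWord m ℓ, F (List.ofFn u.1) * prefixInd (List.ofFn u.1) t := by
  have hlen : (t.take ℓ).length = ℓ := by simp [hℓ]
  obtain ⟨f, hf⟩ : ∃ f : Fin ℓ → Letter, List.ofFn f = t.take ℓ := by
    refine ⟨fun j => (t.take ℓ).get (j.cast hlen.symm), List.ext_getElem (by simp [hlen]) ?_⟩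
    intro i h₁ h₂
    simp
  have hleg : IsLegal m (List.ofFn f) := hf ▸ ht.infix (List.take_prefix _ _).isInfix
  rw [Finset.sum_eq_single (⟨f, hleg⟩ : LegalWord m ℓ)]
  · have : List.ofFn f <+: t := hf ▸ List.take_prefix _ _
    rw [prefixInd, if_pos this, mul_one]
    change F t = F (List.ofFn f)
    rw [hf, hF.take hℓ]
  · intro u _ hu
    rw [prefixInd, if_neg, mul_zero]
    intro h
    refine hu (Subtype.ext (List.ofFn_injective ?_))
    rw [hf]
    rw [List.prefix_iff_eq_take] at h
    simpa using h
  · simp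

/-- With local functions read as row vectors over the legal words, `induce` is right multiplication
by the induced matrix. -/
theorem induce_eq_sum (P : IsPosProb p) {ℓ : ℕ} (hℓ : 1 ≤ ℓ) {F : List Letter → ℝ}
    (hF : IsLocal ℓ F) (w : LegalWord m ℓ) :
    induce p F (List.ofFn w.1) =
      ∑ u : LegalWord m ℓ, F (List.ofFn u.1) * inducedMatrix m p ℓ u w := by
  simp only [inducedMatrix_apply hℓ, ← induce_sum P]
  exact induce_congr P (fun t ht h => local_eq_sum hF ht h) w.2 (by simp)

end Induce

/-! ### The inflation factor and perturbed linear recursions -/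

section Recursion

/-- The inflation factor of `ζ_m`. -/
def inflation (m : ℕ) : ℝ := (m + √((m : ℝ) ^ 2 + 4)) / 2

variable {m : ℕ}

theorem inflation_sq (m : ℕ) : inflation m * inflation m = m * inflation m + 1 := by
  have h : √((m : ℝ) ^ 2 + 4) * √((m : ℝ) ^ 2 + 4) = (m : ℝ) ^ 2 + 4 :=
    Real.mul_self_sqrt (by positivity)
  unfold inflation
  linear_combination h / 4

theorem one_lt_inflation (hm : 1 ≤ m) : 1 < inflation m := by
  have hm' : (1 : ℝ) ≤ m := by exact_mod_cast hm
  have h : 1 < √((m : ℝ) ^ 2 + 4) := by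
    rw [Real.lt_sqrt zero_le_one]
    nlinarith
  unfold inflation
  linarith

/-- The roots of `x² = m x + 1` are `λ` and `-1/λ`. Removing the first, `β_k = α_{k+1} - λ α_k`
satisfies `β_{k+1} = -β_k/λ + e_k` and stays bounded, so the increments of `α_k / λ^k` are
geometrically small. -/
theorem exists_tendsto_of_recursion (hm : 1 ≤ m) {α e : ℕ → ℝ} {C : ℝ}
    (h : ∀ k, α (k + 2) = m * α (k + 1) + α k + e k) (he : ∀ k, |e k| ≤ C) :
    ∃ c, Tendsto (fun k => α k / inflation m ^ k) atTop (𝓝 c) := by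
  set l := inflation m
  have hl : 1 < l := one_lt_inflation hm
  have hl0 : 0 < l := by linarith
  have hl' : l⁻¹ < 1 := inv_lt_one_of_one_lt₀ hl
  have hsq : l * l = m * l + 1 := inflation_sq m
  obtain ⟨D, hD₁, hD₂⟩ : ∃ D, |α 1 - l * α 0| ≤ D ∧ D * l⁻¹ + C ≤ D := by
    -- `C / (1 - l⁻¹)` is the fixed point of `D ↦ D * l⁻¹ + C`; every larger bound is preserved too.
    refine ⟨max |α 1 - l * α 0| (C / (1 - l⁻¹)), le_max_left _ _, ?_⟩
    have := le_max_right |α 1 - l * α 0| (C / (1 - l⁻¹))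
    rw [div_le_iff₀ (by linarith)] at this
    linarith
  have hb : ∀ k, |α (k + 1) - l * α k| ≤ D := by
    intro k
    induction k with
    | zero => exact hD₁
    | succ k ih =>
      have h₁ : α (k + 2) - l * α (k + 1) = -((α (k + 1) - l * α k) * l⁻¹) + e k := by
        rw [h]
        field_simp
        linear_combination (-α (k + 1)) * hsq
      rw [h₁]
      calc _ ≤ |α (k + 1) - l * α k| * l⁻¹ + |e k| := by
            refine (abs_add_le _ _).trans ?_
            rw [abs_neg, abs_mul, abs_of_pos (inv_pos.2 hl0)]
        _ ≤ D * l⁻¹ + C := by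
            have := he k
            gcongr
        _ ≤ D := hD₂
  refine cauchySeq_tendsto_of_complete (cauchySeq_of_le_geometric l⁻¹ (D * l⁻¹) hl' fun k => ?_)
  have h₁ : α k / l ^ k - α (k + 1) / l ^ (k + 1) = -(α (k + 1) - l * α k) * (l⁻¹ * l⁻¹ ^ k) := by
    rw [pow_succ, inv_pow]
    field_simp
    ring
  rw [Real.dist_eq, h₁, abs_mul, abs_neg, mul_assoc, abs_of_pos (a := l⁻¹ * l⁻¹ ^ k) (by positivity)]
  exact mul_le_mul_of_nonneg_right (hb k) (by positivity)

/-- The `λ`-component `b_k = α_{k+1}/λ^k + α_k/λ^{k+1}` increases by `e_k/λ^{k+1} ≥ 0` and tends to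
`c (λ + 1/λ)`, so one positive term suffices. -/
theorem pos_of_recursion (hm : 1 ≤ m) {α e : ℕ → ℝ} {c : ℝ}
    (h : ∀ k, α (k + 2) = m * α (k + 1) + α k + e k) (he : ∀ k, 0 ≤ e k) (hα : ∀ k, 0 ≤ α k)
    (hpos : ∃ k, 0 < α k) (hc : Tendsto (fun k => α k / inflation m ^ k) atTop (𝓝 c)) : 0 < c := by
  obtain ⟨j, hj⟩ := hpos
  set l := inflation m
  have hl : 1 < l := one_lt_inflation hm
  have hl0 : 0 < l := by linarith
  have hsq : l * l = m * l + 1 := inflation_sq m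
  set b : ℕ → ℝ := fun k => α (k + 1) / l ^ (k + 1) * l + α k / l ^ k / l with hb
  have hmono : Monotone b := by
    refine monotone_nat_of_le_succ fun k => ?_
    have : b (k + 1) - b k = e k / l ^ (k + 1) := by
      simp only [hb, h]
      rw [pow_succ, pow_succ]
      field_simp
      linear_combination (-α (k + 1)) * hsq
    have h₂ : 0 ≤ e k / l ^ (k + 1) := div_nonneg (he k) (by positivity)
    linarith
  have hlim : Tendsto b atTop (𝓝 (c * l + c / l)) :=
    (((tendsto_add_atTop_iff_nat 1).2 hc).mul_const l).add (hc.div_const l)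
  have h₁ := hmono.ge_of_tendsto hlim j
  have h₂ : 0 < b j := by
    have := hα (j + 1)
    simp only [hb]
    positivity
  have h₃ : c * l + c / l = c * (l + l⁻¹) := by ring
  rw [h₃] at h₁
  exact pos_of_mul_pos_left (h₂.trans_le h₁) (by positivity)

theorem exists_tendsto_imageLen (hm : 1 ≤ m) : ∃ c : ℝ, 0 < c ∧
    Tendsto (fun k => (imageLen m k Letter.a : ℝ) / inflation m ^ k) atTop (𝓝 c) := by
  have h : ∀ k, (imageLen m (k + 2) Letter.a : ℝ) =
      m * imageLen m (k + 1) Letter.a + imageLen m k Letter.a + 0 := by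
    intro k
    rw [imageLen, imageLen.eq_3]
    push_cast
    ring
  obtain ⟨c, hc⟩ := exists_tendsto_of_recursion hm (α := fun k => (imageLen m k Letter.a : ℝ))
    (e := fun _ => 0) (C := 0) h (by simp)
  exact ⟨c, pos_of_recursion hm (α := fun k => (imageLen m k Letter.a : ℝ)) (e := fun _ => 0) h
    (by simp) (by simp) ⟨0, by simp [imageLen]⟩ hc, hc⟩

theorem tendsto_imageLen_ratio (hm : 1 ≤ m) :
    Tendsto (fun k => (imageLen m (k + 1) Letter.a : ℝ) / imageLen m k Letter.a) atTop
      (𝓝 (inflation m)) := by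
  obtain ⟨c, hc, hlim⟩ := exists_tendsto_imageLen hm
  have hl0 : 0 < inflation m := by linarith [one_lt_inflation hm]
  have := (((tendsto_add_atTop_iff_nat 1).2 hlim).div hlim hc.ne').mul_const (inflation m)
  rw [div_self hc.ne', one_mul] at this
  refine this.congr fun k => ?_
  have := imageLen_pos (m := m) k Letter.a
  simp only [Pi.div_apply, pow_succ]
  field_simp

theorem tendsto_imageLen_atTop (hm : 1 ≤ m) :
    Tendsto (fun k => (imageLen m k Letter.a : ℝ)) atTop atTop :=
  tendsto_atTop_mono (fun k => by exact_mod_cast (lt_imageLen_a hm k).le)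
    tendsto_natCast_atTop_atTop

end Recursion

/-! ### Frequencies of words -/

section Freq

variable {m : ℕ} {p : Fin (m + 1) → ℝ}

theorem expect_b (g : List Letter → ℝ) (P : IsPosProb p) : expect p g [Letter.b] = g [Letter.a] := by
  simp [expect, nms, ← Finset.sum_mul, P.sum_eq_one]

theorem iterate_expect_succ_b (P : IsPosProb p) (k : ℕ) (g : List Letter → ℝ) :
    (expect p)^[k + 1] g [Letter.b] = (expect p)^[k] g [Letter.a] := by
  rw [Function.iterate_succ_apply', expect_b _ P]

/-- The expected number of occurrences is superadditive. -/
theorem iterate_expect_occ_append_ge (P : IsPosProb p) (k : ℕ) (u w₁ w₂ : List Letter) :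
    (expect p)^[k] (occ u) w₁ + (expect p)^[k] (occ u) w₂ ≤ (expect p)^[k] (occ u) (w₁ ++ w₂) := by
  rw [iterate_expect_append P]
  calc _ = (expect p)^[k] (fun v₁ => (expect p)^[k] (fun v₂ => occ u v₁ + occ u v₂) w₂) w₁ := by
        simp only [iterate_expect_add P, iterate_expect_const P]
    _ ≤ _ := iterate_expect_mono P fun v₁ _ => iterate_expect_mono P fun v₂ _ => occ_add_le u v₁ v₂

/-- The expected number of occurrences is subadditive up to a bounded error. -/
theorem iterate_expect_occ_append_le (P : IsPosProb p) (k : ℕ) (u w₁ w₂ : List Letter) :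
    (expect p)^[k] (occ u) (w₁ ++ w₂) ≤
      (expect p)^[k] (occ u) w₁ + (expect p)^[k] (occ u) w₂ + u.length := by
  rw [iterate_expect_append P]
  calc _ ≤ (expect p)^[k] (fun v₁ => (expect p)^[k]
          (fun v₂ => occ u v₁ + occ u v₂ + u.length) w₂) w₁ :=
        iterate_expect_mono P fun v₁ _ => iterate_expect_mono P fun v₂ _ => occ_append_le u v₁ v₂
    _ = _ := by simp only [iterate_expect_add P, iterate_expect_const P]

theorem iterate_expect_occ_bounds (P : IsPosProb p) (k : ℕ) (u w : List Letter) :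
    (w.map fun x => (expect p)^[k] (occ u) [x]).sum ≤ (expect p)^[k] (occ u) w ∧
      (expect p)^[k] (occ u) w ≤
        (w.map fun x => (expect p)^[k] (occ u) [x]).sum + u.length * w.length := by
  induction w with
  | nil => simp [iterate_expect_nil P, occ, tailSum]
  | cons x w ih =>
    have h₁ := iterate_expect_occ_append_ge P k u [x] w
    have h₂ := iterate_expect_occ_append_le P k u [x] w
    rw [List.singleton_append] at h₁ h₂
    simp only [List.map_cons, List.sum_cons, List.length_cons]
    push_cast
    constructor <;> linarith

theorem sum_map_nms_a (f : Letter → ℝ) (i : Fin (m + 1)) :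
    ((nms m i Letter.a).map f).sum = m * f Letter.a + f Letter.b := by
  have hi : (i : ℕ) + ((m - i : ℕ) : ℝ) = m := by
    rw [Nat.cast_sub (by omega)]
    ring
  simp only [nms, List.map_append, List.map_cons, List.map_replicate, List.sum_append,
    List.sum_cons, List.sum_replicate, nsmul_eq_mul]
  linear_combination (f Letter.a) * hi

theorem length_nms_a (i : Fin (m + 1)) : (nms m i Letter.a).length = m + 1 := by
  simp [nms]
  omega

/-- The expected number of occurrences of a word in the realisations of `ζ_m^k(a)` satisfies a
linear recursion up to a bounded error. -/
theorem occ_recursion (P : IsPosProb p) (u : List Letter) :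
    ∃ e : ℕ → ℝ, (∀ k, 0 ≤ e k ∧ e k ≤ u.length * (m + 1)) ∧
      ∀ k, (expect p)^[k + 2] (occ u) [Letter.a] = m * (expect p)^[k + 1] (occ u) [Letter.a] +
        (expect p)^[k] (occ u) [Letter.a] + e k := by
  refine ⟨fun k => (expect p)^[k + 2] (occ u) [Letter.a] -
    m * (expect p)^[k + 1] (occ u) [Letter.a] - (expect p)^[k] (occ u) [Letter.a],
    fun k => ?_, fun k => by ring⟩
  -- The image has `m` letters `a` and one `b`, and `b` at level `k + 1` is `a` at level `k`. Each
  -- of the `m + 1` letters costs at most one seam, hence `u.length`.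
  have hb : ∀ v, IsIterImage m 1 [Letter.a] v →
      m * (expect p)^[k + 1] (occ u) [Letter.a] + (expect p)^[k] (occ u) [Letter.a] ≤
        (expect p)^[k + 1] (occ u) v ∧ (expect p)^[k + 1] (occ u) v ≤
      m * (expect p)^[k + 1] (occ u) [Letter.a] + (expect p)^[k] (occ u) [Letter.a] +
        u.length * (m + 1) := by
    intro v hv
    obtain ⟨i, v', hv', rfl⟩ := isImage_cons.1 (isIterImage_one.1 hv)
    obtain rfl := isImage_nil.1 hv'
    have := iterate_expect_occ_bounds P (k + 1) u (nms m i Letter.a)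
    rw [sum_map_nms_a, iterate_expect_succ_b P, length_nms_a] at this
    simpa using this
  have h₁ : (expect p)^[k + 2] (occ u) [Letter.a] =
      (expect p)^[1] ((expect p)^[k + 1] (occ u)) [Letter.a] := by
    rw [← Function.iterate_add_apply, Nat.add_comm 1]
  have h₂ := iterate_expect_mono P fun v hv => (hb v hv).1
  have h₃ := iterate_expect_mono P fun v hv => (hb v hv).2
  rw [iterate_expect_const P] at h₂ h₃
  simp only [h₁]
  constructor <;> linarith

/-- The frequency of the word `u`. -/
def freq (p : Fin (m + 1) → ℝ) (u : List Letter) : ℝ :=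
  limUnder atTop fun k => (expect p)^[k] (occ u) [Letter.a] / imageLen m k Letter.a

theorem exists_tendsto_occ (hm : 1 ≤ m) (P : IsPosProb p) (u : List Letter) : ∃ c,
    Tendsto (fun k => (expect p)^[k] (occ u) [Letter.a] / inflation m ^ k) atTop (𝓝 c) := by
  obtain ⟨e, he, hrec⟩ := occ_recursion P u
  exact exists_tendsto_of_recursion hm hrec fun k => by rw [abs_of_nonneg (he k).1]; exact (he k).2

theorem div_imageLen_eq (hm : 1 ≤ m) (x : ℝ) (k : ℕ) :
    x / inflation m ^ k / (imageLen m k Letter.a / inflation m ^ k) =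
      x / imageLen m k Letter.a := by
  have := one_lt_inflation hm
  exact div_div_div_cancel_right₀ (by positivity) _ _

theorem tendsto_freq (hm : 1 ≤ m) (P : IsPosProb p) (u : List Letter) :
    Tendsto (fun k => (expect p)^[k] (occ u) [Letter.a] / imageLen m k Letter.a) atTop
      (𝓝 (freq p u)) := by
  obtain ⟨c, hc⟩ := exists_tendsto_occ hm P u
  obtain ⟨d, hd, hlim⟩ := exists_tendsto_imageLen hm
  exact tendsto_nhds_limUnder ⟨c / d, (hc.div hlim hd.ne').congr fun k => div_imageLen_eq hm _ k⟩

theorem freq_pos (hm : 1 ≤ m) (P : IsPosProb p) {u : List Letter} (hu : u ≠ []) (h : IsLegal m u) :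
    0 < freq p u := by
  obtain ⟨e, he, hrec⟩ := occ_recursion P u
  obtain ⟨c, hc⟩ := exists_tendsto_occ hm P u
  obtain ⟨d, hd, hlim⟩ := exists_tendsto_imageLen hm
  have hc0 : 0 < c := by
    refine pos_of_recursion hm hrec (fun k => (he k).1)
      (fun k => iterate_expect_nonneg P (occ_nonneg u)) ?_ hc
    obtain ⟨k, hk, v, hv, huv⟩ := h
    obtain ⟨k, rfl⟩ : ∃ j, k = j + 1 := ⟨k - 1, by omega⟩
    exact ⟨k, iterate_expect_pos P (occ_nonneg u) (isIterImage_succ_b.1 hv) (occ_pos hu huv)⟩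
  rw [tendsto_nhds_unique (tendsto_freq hm P u)
    ((hc.div hlim hd.ne').congr fun k => div_imageLen_eq hm _ k)]
  exact div_pos hc0 hd

/-- Only the suffixes shorter than `n` contribute. -/
theorem abs_tailSum_le {D : List Letter → ℝ} {n : ℕ} {C : ℝ} {v : List Letter}
    (h₀ : ∀ t, t <:+ v → n ≤ t.length → D t = 0) (h₁ : ∀ t, t.length < n → |D t| ≤ C) :
    |tailSum D v| ≤ (min v.length n : ℕ) * C := by
  induction v with
  | nil => simp [tailSum]
  | cons x v ih =>
    have ih' := ih fun t ht => h₀ t (ht.trans (List.suffix_cons x v))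
    simp only [tailSum]
    by_cases hn : n ≤ (x :: v).length
    · rw [h₀ _ List.suffix_rfl hn, zero_add]
      refine ih'.trans ?_
      rcases n.eq_zero_or_pos with rfl | hn0
      · simp
      have hC : 0 ≤ C := (abs_nonneg _).trans (h₁ [] (by simpa using hn0))
      gcongr
      exact Nat.le_succ _
    · have h₂ := h₁ (x :: v) (by omega)
      simp only [List.length_cons] at hn ⊢
      rw [min_eq_left (by omega)] at ih' ⊢
      push_cast
      linarith [abs_add_le (D (x :: v)) (tailSum D v)]

/-- The averages of a bounded local function along the realisations of `ζ_m^k(a)` converge in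
mean. -/
theorem tendsto_tailSum (hm : 1 ≤ m) (P : IsPosProb p) {ℓ : ℕ} {F : List Letter → ℝ}
    (hF : IsLocal ℓ F) {C : ℝ} (hC : ∀ t, |F t| ≤ C) :
    Tendsto (fun k => (expect p)^[k] (tailSum F) [Letter.a] / imageLen m k Letter.a) atTop
      (𝓝 (∑ u : LegalWord m ℓ, F (List.ofFn u.1) * freq p (List.ofFn u.1))) := by
  set G : List Letter → ℝ := fun v =>
    ∑ u : LegalWord m ℓ, F (List.ofFn u.1) * occ (List.ofFn u.1) v with hG
  have h₁ : Tendsto (fun k => (expect p)^[k] G [Letter.a] / imageLen m k Letter.a) atTop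
      (𝓝 (∑ u : LegalWord m ℓ, F (List.ofFn u.1) * freq p (List.ofFn u.1))) := by
    simp only [hG, iterate_expect_sum P, iterate_expect_const_mul P, Finset.sum_div, mul_div_assoc]
    exact tendsto_finsetSum _ fun u _ => (tendsto_freq hm P _).const_mul _
  have h₂ : Tendsto (fun k => (ℓ * C) / (imageLen m k Letter.a : ℝ)) atTop (𝓝 0) :=
    (tendsto_imageLen_atTop hm).const_div_atTop _
  refine (h₁.congr_dist (squeeze_zero (fun _ => dist_nonneg) (fun k => ?_) h₂))
  -- On legal suffixes of length at least `ℓ` the function is the combination of prefix indicators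
  -- in `local_eq_sum`; on shorter ones all these indicators vanish and `F` is bounded by `C`.
  have hbound : ∀ v, IsIterImage m k [Letter.a] v → |G v - tailSum F v| ≤ ℓ * C := by
    intro v hv
    have hDeq : G v - tailSum F v = tailSum (fun t =>
        ∑ u : LegalWord m ℓ, F (List.ofFn u.1) * prefixInd (List.ofFn u.1) t + (-1) * F t) v := by
      have hadd : ∀ F₁ F₂ : List Letter → ℝ, ∀ v,
          tailSum (fun t => F₁ t + F₂ t) v = tailSum F₁ v + tailSum F₂ v := by
        intro F₁ F₂ v
        simp [tailSum_eq_sum_range, Finset.sum_add_distrib]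
      rw [hadd, tailSum_sum, tailSum_const_mul]
      simp only [tailSum_const_mul, hG, occ]
      ring
    have hC0 : 0 ≤ C := (abs_nonneg _).trans (hC [])
    rw [hDeq]
    refine (abs_tailSum_le (n := ℓ) (C := C) (fun t ht hn => ?_) fun t ht => ?_).trans ?_
    · rw [← local_eq_sum hF (hv.isLegal.infix ht.isInfix) hn]
      ring
    · rw [Finset.sum_eq_zero, zero_add, neg_one_mul, abs_neg]
      · exact hC t
      · intro u _
        rw [prefixInd, if_neg, mul_zero]
        intro h
        have := h.length_le
        simp at this
        omega
    · gcongr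
      exact min_le_right _ _
  have hpos : (0 : ℝ) < imageLen m k Letter.a := by exact_mod_cast imageLen_pos k _
  rw [Real.dist_eq, ← sub_div, abs_div, abs_of_pos hpos, ← iterate_expect_sub P]
  gcongr
  rw [abs_le]
  constructor
  · rw [← iterate_expect_const P k [Letter.a] (-(ℓ * C))]
    exact iterate_expect_mono P fun v hv => (abs_le.1 (hbound v hv)).1
  · exact iterate_expect_le_const P fun v hv => (abs_le.1 (hbound v hv)).2

theorem sum_freq (hm : 1 ≤ m) (P : IsPosProb p) (ℓ : ℕ) :
    ∑ u : LegalWord m ℓ, freq p (List.ofFn u.1) = 1 := by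
  have h := tendsto_tailSum hm P (ℓ := ℓ) (F := fun _ => 1) (fun _ _ _ => rfl) (C := 1) (by simp)
  simp only [one_mul] at h
  refine tendsto_nhds_unique h (tendsto_const_nhds.congr fun k => ?_)
  rw [iterate_expect_eq_const P (c := (imageLen m k Letter.a : ℝ))]
  · have := imageLen_pos (m := m) k Letter.a
    field_simp
  · intro v hv
    simp [tailSum_const, hv.length_eq]

/-! ### Frequencies as the unique Perron–Frobenius eigenvector. -/

theorem abs_induce_prefixInd_le (P : IsPosProb p) (u t : List Letter) :
    |induce p (prefixInd u) t| ≤ m + 1 := by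
  cases t with
  | nil => simp [induce]; positivity
  | cons x z =>
    have h := iterate_induce_cons' P 1 (prefixInd u) x z
    rw [Function.iterate_one] at h
    rw [h, abs_of_nonneg]
    · refine iterate_expect_le_const P fun B hB => iterate_expect_le_const P fun v _ => ?_
      refine (tailSum_mono fun t _ _ => prefixInd_le_one u _).trans ?_
      rw [tailSum_const, hB.length_eq, mul_one]
      cases x <;> simp [imageLen]
    · exact iterate_expect_nonneg P fun B => iterate_expect_nonneg P fun v =>
        tailSum_nonneg (fun t => prefixInd_nonneg u _) _

/-- The expected count of `u` at level `k + 1`, divided by the length at level `k`, has two limits.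
The ratio of lengths gives `λ * freq`; moving one step onto the indicator of `u` gives the mean of a
local function, which is the matrix product. -/
theorem inducedMatrix_mulVec_freq (hm : 1 ≤ m) (P : IsPosProb p) {ℓ : ℕ} (hℓ : 1 ≤ ℓ) :
    (inducedMatrix m p ℓ).mulVec (fun w => freq p (List.ofFn w.1)) =
      inflation m • fun w : LegalWord m ℓ => freq p (List.ofFn w.1) := by
  funext u
  have hloc : IsLocal ℓ (induce p (prefixInd (List.ofFn u.1))) := by
    have := (isLocal_prefixInd (List.ofFn u.1)).induce P (by simpa using hℓ)
    simpa using this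
  have h := tendsto_tailSum hm P hloc (abs_induce_prefixInd_le P _)
  have h' := ((tendsto_add_atTop_iff_nat 1).2 (tendsto_freq hm P (List.ofFn u.1))).mul
    (tendsto_imageLen_ratio hm)
  simp only [Matrix.mulVec, dotProduct, inducedMatrix_apply hℓ, Pi.smul_apply, smul_eq_mul]
  rw [mul_comm]
  refine tendsto_nhds_unique h (h'.congr fun k => ?_)
  have h₁ := imageLen_pos (m := m) k Letter.a
  have h₂ := imageLen_pos (m := m) (k + 1) Letter.a
  rw [Function.iterate_succ_apply, show expect p (occ (List.ofFn u.1)) =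
    tailSum (induce p (prefixInd (List.ofFn u.1))) from funext (expect_tailSum P _)]
  field_simp

/-- A positive eigenvector belongs to an eigenvalue of maximal modulus. -/
theorem norm_le_of_pos_eigenvector {ι : Type*} [Fintype ι] {M : Matrix ι ι ℝ} {R : ι → ℝ} {r : ℝ}
    (hM : ∀ i j, 0 ≤ M i j) (hR : ∀ i, 0 < R i) (h : M.mulVec R = r • R) {z : ℂ} {x : ι → ℂ}
    (hx : x ≠ 0) (hz : (M.map Complex.ofReal).mulVec x = z • x) : ‖z‖ ≤ r := by
  obtain ⟨i₀, hi₀⟩ := Function.ne_iff.1 hx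
  -- The eigenvalue equation is read at an index where `x` attains its sup norm weighted by `R`.
  obtain ⟨i, -, hi⟩ := Finset.exists_max_image Finset.univ (fun i => ‖x i‖ / R i)
    ⟨i₀, Finset.mem_univ _⟩
  set t := ‖x i‖ / R i with ht
  have hxt : ∀ j, ‖x j‖ ≤ t * R j := fun j => by
    have := hi j (Finset.mem_univ j)
    rwa [div_le_iff₀ (hR j)] at this
  have ht0 : 0 < t := by
    have h₁ := hi i₀ (Finset.mem_univ _)
    have h₂ : 0 < ‖x i₀‖ / R i₀ := div_pos (norm_pos_iff.2 hi₀) (hR _)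
    exact h₂.trans_le h₁
  have hxi : ‖x i‖ = t * R i := by
    rw [ht, div_mul_cancel₀ _ (hR i).ne']
  have h₁ : ‖z‖ * ‖x i‖ ≤ t * (r * R i) := by
    have h₂ := congrFun hz i
    have h₃ := congrFun h i
    simp only [Matrix.mulVec, dotProduct, Matrix.map_apply, Pi.smul_apply, smul_eq_mul] at h₂ h₃
    rw [← norm_mul, ← h₂, ← h₃, Finset.mul_sum]
    refine (norm_sum_le _ _).trans (Finset.sum_le_sum fun j _ => ?_)
    rw [norm_mul, Complex.norm_real, Real.norm_of_nonneg (hM i j), mul_left_comm]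
    exact mul_le_mul_of_nonneg_left (hxt j) (hM i j)
  rw [hxi, mul_left_comm] at h₁
  exact le_of_mul_le_mul_right (le_of_mul_le_mul_left h₁ ht0) (hR i)

theorem inducedMatrix_nonneg (P : IsPosProb p) (ℓ : ℕ) (u w : LegalWord m ℓ) :
    0 ≤ inducedMatrix m p ℓ u w :=
  Finset.sum_nonneg fun _ _ =>
    mul_nonneg (Finset.prod_nonneg fun _ _ => (P.pos _).le) (Nat.cast_nonneg _)

theorem freq_ofFn_pos (hm : 1 ≤ m) (P : IsPosProb p) {ℓ : ℕ} (hℓ : 1 ≤ ℓ) (w : LegalWord m ℓ) :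
    0 < freq p (List.ofFn w.1) :=
  freq_pos hm P (by rw [Ne, List.ofFn_eq_nil_iff]; omega) w.2

theorem isRightPF_freq (hm : 1 ≤ m) (P : IsPosProb p) {ℓ : ℕ} (hℓ : 1 ≤ ℓ) :
    IsRightPF (inducedMatrix m p ℓ) fun w => freq p (List.ofFn w.1) :=
  ⟨freq_ofFn_pos hm P hℓ, sum_freq hm P ℓ, inflation m, inducedMatrix_mulVec_freq hm P hℓ,
    fun _ _ hx hz => norm_le_of_pos_eigenvector (inducedMatrix_nonneg P ℓ) (freq_ofFn_pos hm P hℓ)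
      (inducedMatrix_mulVec_freq hm P hℓ) hx hz⟩

theorem ofReal_mulVec {ι : Type*} [Fintype ι] {M : Matrix ι ι ℝ} {R : ι → ℝ} {r : ℝ}
    (h : M.mulVec R = r • R) :
    (M.map Complex.ofReal).mulVec (fun i => (R i : ℂ)) = (r : ℂ) • fun i => (R i : ℂ) := by
  funext i
  have := congrArg Complex.ofReal (congrFun h i)
  simpa [Matrix.mulVec, dotProduct] using this

theorem IsRightPF.ofReal_ne_zero {ι : Type*} [Fintype ι] {M : Matrix ι ι ℝ} {R : ι → ℝ}
    (h : IsRightPF M R) : (fun i => (R i : ℂ)) ≠ 0 := by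
  intro h₀
  have h₁ : ∀ i, R i = 0 := fun i => by simpa using congrFun h₀ i
  have := h.2.1
  simp [h₁] at this

/-- Pairing the row vector `F M^k` with the right eigenvector `R`. -/
theorem iterate_induce_sum (P : IsPosProb p) {ℓ : ℕ} (hℓ : 1 ≤ ℓ) {R : LegalWord m ℓ → ℝ} {r : ℝ}
    (h : (inducedMatrix m p ℓ).mulVec R = r • R) {F : List Letter → ℝ} (hF : IsLocal ℓ F) (k : ℕ) :
    ∑ w, R w * (induce p)^[k] F (List.ofFn w.1) = r ^ k * ∑ w, R w * F (List.ofFn w.1) := by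
  induction k with
  | zero => simp
  | succ k ih =>
    rw [pow_succ', mul_assoc, ← ih, Function.iterate_succ_apply']
    simp only [induce_eq_sum P hℓ (hF.iterate_induce P hℓ k), Finset.mul_sum]
    rw [Finset.sum_comm]
    refine Finset.sum_congr rfl fun u _ => ?_
    have := congrFun h u
    simp only [Matrix.mulVec, dotProduct, Pi.smul_apply, smul_eq_mul] at this
    rw [← mul_assoc, ← this, Finset.sum_mul]
    exact Finset.sum_congr rfl fun w _ => by ring

/-- Both terms count occurrences starting in the image of `x`; they differ by those that run out of
it. So only the first letter matters asymptotically. -/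
theorem abs_iterate_induce_sub_le (P : IsPosProb p) (k : ℕ) (u : List Letter) (x : Letter)
    (z : List Letter) :
    |(induce p)^[k] (prefixInd u) (x :: z) - (expect p)^[k] (occ u) [x]| ≤ u.length := by
  rw [iterate_induce_cons P]
  have h₁ := iterate_expect_occ_append_ge P k u [x] z
  have h₂ := iterate_expect_occ_append_le P k u [x] z
  rw [List.singleton_append] at h₁ h₂
  simp only [occ] at h₁ h₂ ⊢
  rw [abs_le]
  have : (0 : ℝ) ≤ u.length := Nat.cast_nonneg _
  constructor <;> linarith

/-- The point is that `c` does not depend on `u`: it is `1` for `a` and `1/λ` for `b`, whose image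
lags one level behind. -/
theorem exists_tendsto_occ_letter (hm : 1 ≤ m) (P : IsPosProb p) (x : Letter) :
    ∃ c : ℝ, ∀ u, Tendsto (fun k => (expect p)^[k] (occ u) [x] / imageLen m k Letter.a) atTop
      (𝓝 (c * freq p u)) := by
  cases x with
  | a => exact ⟨1, fun u => by simpa using tendsto_freq hm P u⟩
  | b =>
    refine ⟨(inflation m)⁻¹, fun u => ?_⟩
    have hl := one_lt_inflation hm
    rw [← tendsto_add_atTop_iff_nat 1]
    refine (((tendsto_imageLen_ratio hm).inv₀ (by linarith)).mul (tendsto_freq hm P u)).congr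
      fun k => ?_
    have := imageLen_pos (m := m) k Letter.a
    rw [iterate_expect_succ_b P]
    field_simp

/-- The normalised right Perron–Frobenius eigenvector of the induced substitution matrix is
unique. -/
theorem IsRightPF.eq_freq (hm : 1 ≤ m) (P : IsPosProb p) {ℓ : ℕ} (hℓ : 1 ≤ ℓ)
    {R : LegalWord m ℓ → ℝ} (hR : IsRightPF (inducedMatrix m p ℓ) R) (w : LegalWord m ℓ) :
    R w = freq p (List.ofFn w.1) := by
  obtain ⟨hpos, hsum, r, hr, hmax⟩ := id hR
  have hl := one_lt_inflation hm
  have hr' : r = inflation m := by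
    -- Each of the two positive eigenvectors makes its eigenvalue dominate the other.
    refine le_antisymm ?_ ?_
    · have := norm_le_of_pos_eigenvector (inducedMatrix_nonneg P ℓ) (freq_ofFn_pos hm P hℓ)
        (inducedMatrix_mulVec_freq hm P hℓ) hR.ofReal_ne_zero (ofReal_mulVec hr)
      rw [Complex.norm_real] at this
      exact (le_abs_self r).trans this
    · have := hmax _ _ (isRightPF_freq hm P hℓ).ofReal_ne_zero
        (ofReal_mulVec (inducedMatrix_mulVec_freq hm P hℓ))
      rw [Complex.norm_real] at this
      exact (le_abs_self _).trans this
  subst hr'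
  obtain ⟨d, hd, hdlim⟩ := exists_tendsto_imageLen hm
  choose c hc using fun x => exists_tendsto_occ_letter (p := p) hm P x
  obtain ⟨n, rfl⟩ : ∃ n, ℓ = n + 1 := ⟨ℓ - 1, by omega⟩
  -- The identity `λ^k R(u) = Σ_w R(w) (induce^k 1_u)(w)` is divided by the length at level `k`. In
  -- the limit `R` is a multiple of `freq` with a factor independent of `u`, which the normalisation
  -- fixes; irreducibility of the matrix is not needed.
  have key : ∀ u : LegalWord m (n + 1),
      R u = d * (∑ w, R w * c (w.1 0)) * freq p (List.ofFn u.1) := by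
    intro u
    have h₁ : ∀ k, ∑ w, R w * (induce p)^[k] (prefixInd (List.ofFn u.1)) (List.ofFn w.1) =
        inflation m ^ k * R u := by
      intro k
      have hloc : IsLocal (n + 1) (prefixInd (List.ofFn u.1)) := by
        simpa using isLocal_prefixInd (List.ofFn u.1)
      rw [iterate_induce_sum P hℓ hr hloc, Finset.sum_eq_single u]
      · simp [prefixInd]
      · intro w _ hw
        rw [prefixInd, if_neg, mul_zero]
        intro h
        exact hw (Subtype.ext (List.ofFn_injective (h.eq_of_length (by simp)).symm))
      · simp
    have h₂ : ∀ w : LegalWord m (n + 1), Tendsto (fun k =>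
        (induce p)^[k] (prefixInd (List.ofFn u.1)) (List.ofFn w.1) / imageLen m k Letter.a) atTop
          (𝓝 (c (w.1 0) * freq p (List.ofFn u.1))) := by
      intro w
      refine (hc (w.1 0) _).congr_dist (squeeze_zero (fun _ => dist_nonneg) (fun k => ?_)
        ((tendsto_imageLen_atTop hm).const_div_atTop ((List.ofFn u.1).length : ℝ)))
      have hp : (0 : ℝ) < imageLen m k Letter.a := by exact_mod_cast imageLen_pos k _
      rw [Real.dist_eq, ← sub_div, abs_div, abs_of_pos hp, abs_sub_comm, List.ofFn_succ (f := w.1)]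
      have := abs_iterate_induce_sub_le P k (List.ofFn u.1) (w.1 0) (List.ofFn fun i => w.1 i.succ)
      gcongr
    have h₃ := tendsto_finsetSum Finset.univ fun w _ => (h₂ w).const_mul (R w)
    have h₄ : Tendsto (fun k => R u / (imageLen m k Letter.a / inflation m ^ k)) atTop
        (𝓝 (R u / d)) := tendsto_const_nhds.div hdlim hd.ne'
    have h₅ := tendsto_nhds_unique h₄ (h₃.congr fun k => ?_)
    · rw [div_eq_iff hd.ne'] at h₅
      rw [h₅]
      simp only [← mul_assoc, ← Finset.sum_mul]
      ring
    · simp only [← mul_div_assoc, ← Finset.sum_div, h₁]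
      field_simp
  have hone : d * (∑ w, R w * c (w.1 0)) = 1 := by
    have := hsum
    rwa [Finset.sum_congr rfl fun u _ => key u, ← Finset.mul_sum, sum_freq hm P, mul_one] at this
  rw [key w, hone, one_mul]

end Freq

/-! ### Second moments of the number of occurrences -/

section SecondMoment

variable {m : ℕ} {p : Fin (m + 1) → ℝ}

theorem freq_nonneg (hm : 1 ≤ m) (P : IsPosProb p) (u : List Letter) : 0 ≤ freq p u :=
  ge_of_tendsto' (tendsto_freq hm P u) fun _ =>
    div_nonneg (iterate_expect_nonneg P (occ_nonneg u)) (Nat.cast_nonneg _)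

theorem freq_le_one (hm : 1 ≤ m) (P : IsPosProb p) (u : List Letter) : freq p u ≤ 1 := by
  refine le_of_tendsto' (tendsto_freq hm P u) fun k => div_le_one_of_le₀ ?_ (Nat.cast_nonneg _)
  refine iterate_expect_le_const P fun v hv => (occ_le_length u v).trans ?_
  rw [hv.length_eq]
  simp

theorem eventually_abs_occ_sub_le (hm : 1 ≤ m) (P : IsPosProb p) (u : List Letter) {ε : ℝ}
    (hε : 0 < ε) : ∀ᶠ k in atTop, ∀ x : Letter,
      |(expect p)^[k] (occ u) [x] - freq p u * imageLen m k x| ≤ ε * imageLen m k x := by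
  have h : ∀ᶠ k in atTop, |(expect p)^[k] (occ u) [Letter.a] -
      freq p u * imageLen m k Letter.a| ≤ ε * imageLen m k Letter.a := by
    filter_upwards [Metric.tendsto_nhds.1 (tendsto_freq hm P u) ε hε] with k hk
    have hp : (0 : ℝ) < imageLen m k Letter.a := by exact_mod_cast imageLen_pos k _
    rw [Real.dist_eq, div_sub' hp.ne', abs_div, abs_of_pos hp, div_lt_iff₀ hp] at hk
    rw [mul_comm (freq p u)]
    exact hk.le
  obtain ⟨n, hn⟩ := eventually_atTop.1 h
  refine eventually_atTop.2 ⟨n + 1, fun k hk x => ?_⟩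
  obtain ⟨k, rfl⟩ : ∃ j, k = j + 1 := ⟨k - 1, by omega⟩
  cases x with
  | a => exact hn _ (by omega)
  | b =>
    rw [iterate_expect_succ_b P]
    exact hn k (by omega)

/-- `X` adds the deviations `occ u B - c * B.length` over the blocks `B` coming from the letters of
`y`. Blocks are independent, so variances add, each at most the squared maximal block length;
neglecting seams costs at most `u.length` per block. -/
theorem exists_block_sum (hm : 1 ≤ m) (P : IsPosProb p) {k : ℕ} {u : List Letter} {c ε : ℝ}
    (hc₀ : 0 ≤ c) (hc₁ : c ≤ 1)
    (h : ∀ x, |(expect p)^[k] (occ u) [x] - c * imageLen m k x| ≤ ε * imageLen m k x)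
    (y : List Letter) :
    ∃ X : List Letter → ℝ,
      (∀ v, IsIterImage m k y v → |occ u v - c * v.length - X v| ≤ u.length * y.length) ∧
      |(expect p)^[k] X y| ≤ ε * wordLen m k y ∧
      (expect p)^[k] (fun v => X v ^ 2) y ≤
        y.length * (imageLen m k Letter.a : ℝ) ^ 2 + ((expect p)^[k] X y) ^ 2 := by
  induction y with
  | nil =>
    refine ⟨fun _ => 0, fun v hv => ?_, ?_, ?_⟩
    · simp [isIterImage_nil.1 hv, occ, tailSum]
    · simp [iterate_expect_const P]
    · simp [iterate_expect_const P]
  | cons x y ih =>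
    obtain ⟨X, hX, hX₁, hX₂⟩ := ih
    set Z : List Letter → ℝ := fun B => occ u B - c * B.length with hZ
    set H : ℝ := Nat.cast (imageLen m k Letter.a) with hH
    have hZE : (expect p)^[k] Z [x] = (expect p)^[k] (occ u) [x] - c * imageLen m k x := by
      rw [hZ, iterate_expect_sub P, iterate_expect_const_mul P]
      congr 2
      exact iterate_expect_eq_const P fun v hv => by rw [hv.length_eq]; simp
    have hZH : (expect p)^[k] (fun B => Z B ^ 2) [x] ≤ H ^ 2 := by
      refine iterate_expect_le_const P fun B hB => sq_le_sq' ?_ ?_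
      all_goals
        have h₁ : (B.length : ℝ) ≤ H := by
          rw [hB.length_eq]
          simpa [hH] using imageLen_le_a hm k x
        have h₂ := occ_nonneg u B
        have h₃ := occ_le_length u B
        have h₄ : c * B.length ≤ B.length := mul_le_of_le_one_left (Nat.cast_nonneg _) hc₁
        have h₅ : 0 ≤ c * B.length := mul_nonneg hc₀ (Nat.cast_nonneg _)
        simp only [hZ]
        linarith
    have hsplit : ∀ (G : ℝ → ℝ), (expect p)^[k]
        (fun v => G (Z (v.take (imageLen m k x)) + X (v.drop (imageLen m k x)))) (x :: y) =
          (expect p)^[k] (fun B => (expect p)^[k] (fun v => G (Z B + X v)) y) [x] := by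
      intro G
      rw [← List.singleton_append, iterate_expect_append P]
      refine iterate_expect_congr P fun B hB => iterate_expect_congr P fun v _ => ?_
      have hlen : B.length = imageLen m k x := by simpa using hB.length_eq
      rw [List.take_left' hlen, List.drop_left' hlen]
    have hE : (expect p)^[k]
        (fun v => Z (v.take (imageLen m k x)) + X (v.drop (imageLen m k x))) (x :: y) =
          (expect p)^[k] Z [x] + (expect p)^[k] X y := by
      rw [hsplit fun t => t]
      simp only [iterate_expect_add P, iterate_expect_const P]
    -- The first block can be cut off at a fixed position because its length is deterministic.
    refine ⟨fun v => Z (v.take (imageLen m k x)) + X (v.drop (imageLen m k x)), ?_, ?_, ?_⟩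
    · intro v hv
      rw [← List.singleton_append, isIterImage_append] at hv
      obtain ⟨B, v, hB, hv, rfl⟩ := hv
      have hlen : B.length = imageLen m k x := by simpa using hB.length_eq
      beta_reduce
      rw [List.take_left' hlen, List.drop_left' hlen]
      have h₁ := abs_le.1 (hX v hv)
      have h₂ := occ_add_le u B v
      have h₃ := occ_append_le u B v
      simp only [hZ, List.length_append, List.length_cons]
      push_cast
      rw [abs_le]
      constructor <;> linarith
    · rw [hE, hZE]
      have h₁ := h x
      simp only [wordLen_cons]
      push_cast
      linarith [abs_add_le ((expect p)^[k] (occ u) [x] - c * imageLen m k x) ((expect p)^[k] X y)]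
    · rw [hE, hsplit fun t => t ^ 2]
      have h₁ : ∀ B, (expect p)^[k] (fun v => (Z B + X v) ^ 2) y =
          Z B ^ 2 + 2 * (expect p)^[k] X y * Z B + (expect p)^[k] (fun v => X v ^ 2) y := by
        intro B
        have : (fun v => (Z B + X v) ^ 2) = fun v => (Z B ^ 2 + (2 * Z B) * X v) + X v ^ 2 := by
          funext v
          ring
        rw [this, iterate_expect_add P, iterate_expect_add P, iterate_expect_const P,
          iterate_expect_const_mul P]
        ring
      simp only [h₁, iterate_expect_add P, iterate_expect_const P, iterate_expect_const_mul P,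
        List.length_cons]
      push_cast
      -- This is `Var Z ≤ E Z² ≤ H²`.
      nlinarith [sq_nonneg ((expect p)^[k] Z [x])]

/-- Greedy choice: letters are taken as long as their blocks fit into length `N`, so less than one
maximal block is left unused unless `z` ends first. -/
theorem exists_split_wordLen (hm : 1 ≤ m) (k N : ℕ) (z : List Letter) :
    ∃ y y', z = y ++ y' ∧ wordLen m k y ≤ N ∧
      (y' = [] ∨ N < wordLen m k y + imageLen m k Letter.a) := by
  induction z generalizing N with
  | nil => exact ⟨[], [], rfl, by simp, Or.inl rfl⟩
  | cons x z ih =>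
    by_cases h : imageLen m k x ≤ N
    · obtain ⟨y, y', rfl, h₁, h₂⟩ := ih (N - imageLen m k x)
      refine ⟨x :: y, y', rfl, ?_, h₂.imp_right fun h₂ => ?_⟩ <;> simp only [wordLen_cons] <;> omega
    · refine ⟨[], x :: z, rfl, by simp, Or.inr ?_⟩
      have := imageLen_le_a hm k x
      simp
      omega

/-- The squared deviation of the number of occurrences of `u` in the window of length `W` at the
beginning of a word. -/
def windowDev (u : List Letter) (c : ℝ) (W : ℕ) (t : List Letter) : ℝ :=
  if W ≤ t.length then (occ u (t.take W) - c * W) ^ 2 else 0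

theorem windowDev_nonneg (u : List Letter) (c : ℝ) (W : ℕ) (t : List Letter) :
    0 ≤ windowDev u c W t := by
  unfold windowDev
  split_ifs <;> positivity

theorem isLocal_windowDev (u : List Letter) (c : ℝ) (W : ℕ) : IsLocal W (windowDev u c W) := by
  intro s t hs
  rw [windowDev, windowDev, if_pos hs, if_pos (by simp; omega), List.take_append_of_le_length hs]

theorem abs_windowDev_le {u : List Letter} {c : ℝ} (hc₀ : 0 ≤ c) (hc₁ : c ≤ 1) (W : ℕ)
    (t : List Letter) : |windowDev u c W t| ≤ (W : ℝ) ^ 2 := by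
  rw [abs_of_nonneg (windowDev_nonneg _ _ _ _), windowDev]
  split_ifs with h
  · have h₁ := occ_nonneg u (t.take W)
    have h₂ := occ_le_length u (t.take W)
    rw [List.length_take, min_eq_left h] at h₂
    have h₃ : c * W ≤ W := mul_le_of_le_one_left (Nat.cast_nonneg _) hc₁
    have h₄ : 0 ≤ c * W := mul_nonneg hc₀ (Nat.cast_nonneg _)
    exact sq_le_sq' (by linarith) (by linarith)
  · positivity

/-- The window at the beginning of `t ++ v₁ ++ v₂` contains about as many occurrences as `v₁`. -/
theorem windowDev_le {u t v₁ v₂ : List Letter} {c : ℝ} {W H : ℕ} {x e : ℝ} (hc₀ : 0 ≤ c)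
    (hc₁ : c ≤ 1) (ht : t.length ≤ H) (h₁ : v₁.length + H ≤ W)
    (h₂ : v₂ = [] ∨ W < v₁.length + 2 * H) (hx : |occ u v₁ - c * v₁.length - x| ≤ e) :
    windowDev u c W (t ++ (v₁ ++ v₂)) ≤ 3 * x ^ 2 + 3 * e ^ 2 + 3 * (3 * H + u.length) ^ 2 := by
  unfold windowDev
  split_ifs with h
  swap
  · positivity
  obtain ⟨r, hr, hr', hW⟩ : ∃ r, (t ++ (v₁ ++ v₂)).take W = t ++ (v₁ ++ r) ∧ r.length ≤ 2 * H ∧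
      W = t.length + v₁.length + r.length := by
    simp only [List.length_append] at h
    refine ⟨v₂.take (W - t.length - v₁.length), ?_, ?_, ?_⟩
    · rw [List.take_append, List.take_append, List.take_of_length_le (by omega),
        List.take_of_length_le (l := v₁) (by omega)]
    · rcases h₂ with rfl | h₂
      · simp
      · rw [List.length_take]
        omega
    · rw [List.length_take]
      omega
  have hWr : (W : ℝ) = t.length + v₁.length + r.length := by exact_mod_cast hW
  have htH : (t.length : ℝ) ≤ H := by exact_mod_cast ht
  have hrH : (r.length : ℝ) ≤ 2 * H := by exact_mod_cast hr'
  set d : ℝ := occ u (t ++ (v₁ ++ r)) - c * W - (occ u v₁ - c * v₁.length) with hd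
  -- At most `H` letters overhang on the left and `2 * H` on the right, and only the seam between
  -- `v₁` and `r` needs the extra `u.length`.
  have hd' : |d| ≤ 3 * H + u.length := by
    have b₁ := occ_add_le u t (v₁ ++ r)
    have b₂ := occ_add_le u v₁ r
    have b₃ := occ_append_le_length u t (v₁ ++ r)
    have b₄ := occ_append_le u v₁ r
    have b₅ := occ_le_length u r
    have b₆ := occ_nonneg u t
    have b₇ := occ_nonneg u r
    have b₈ : c * (t.length + r.length) ≤ t.length + r.length :=
      mul_le_of_le_one_left (by positivity) hc₁
    have b₉ : 0 ≤ c * (t.length + r.length) := by positivity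
    have b : d = occ u (t ++ (v₁ ++ r)) - occ u v₁ - c * (t.length + r.length) := by
      rw [hd, hWr]
      ring
    have b' : (0 : ℝ) ≤ u.length := Nat.cast_nonneg _
    rw [b, abs_le]
    constructor <;> linarith
  have hsq₁ := sq_le_sq' (abs_le.1 hd').1 (abs_le.1 hd').2
  have hsq₂ := sq_le_sq' (abs_le.1 hx).1 (abs_le.1 hx).2
  rw [hr]
  set f : ℝ := occ u v₁ - c * v₁.length - x
  have : occ u (t ++ (v₁ ++ r)) - c * W = x + f + d := by
    simp only [hd, f]
    ring
  rw [this]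
  nlinarith [sq_nonneg (x - f), sq_nonneg (x - d), sq_nonneg (f - d)]

theorem length_mul_le_wordLen (k : ℕ) (y : List Letter) (hm : 1 ≤ m) :
    y.length * k ≤ wordLen m k y := by
  induction y with
  | nil => simp
  | cons x y ih =>
    have := le_imageLen hm k x
    simp only [List.length_cons, wordLen_cons]
    linarith

/-- A window starting in the image of `x` consists of the end of that block, the full blocks of some
`y`, and a short remainder. `exists_block_sum` controls the middle; the leading factor counts the
starting positions. -/
theorem iterate_induce_windowDev_le (hm : 1 ≤ m) (P : IsPosProb p) {k : ℕ} {u : List Letter}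
    {c ε : ℝ} (hc₀ : 0 ≤ c) (hc₁ : c ≤ 1) (hε : 0 ≤ ε) (huk : u.length ≤ ε * k)
    (h : ∀ x, |(expect p)^[k] (occ u) [x] - c * imageLen m k x| ≤ ε * imageLen m k x) {W : ℕ}
    (hW : imageLen m k Letter.a ≤ W) (x : Letter) (z : List Letter) :
    (induce p)^[k] (windowDev u c W) (x :: z) ≤ imageLen m k x *
      (3 * W * (imageLen m k Letter.a : ℝ) ^ 2 + 6 * (ε * W) ^ 2 +
        3 * (3 * imageLen m k Letter.a + u.length) ^ 2) := by
  -- One maximal block length is reserved for the partial block on the left.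
  obtain ⟨y, y', rfl, hy, hy'⟩ := exists_split_wordLen hm k (W - imageLen m k Letter.a) z
  obtain ⟨X, hX, hX₁, hX₂⟩ := exists_block_sum hm P hc₀ hc₁ h y
  set H := imageLen m k Letter.a with hH
  rw [iterate_induce_cons' P]
  refine iterate_expect_le_const P fun B hB => ?_
  have hBlen : B.length = imageLen m k x := by simpa using hB.length_eq
  have hBH : B.length ≤ H := hBlen.trans_le (imageLen_le_a hm k x)
  have hyW : (wordLen m k y : ℝ) ≤ W := by exact_mod_cast hy.trans (Nat.sub_le _ _)
  have hyk : (y.length : ℝ) * k ≤ wordLen m k y := by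
    exact_mod_cast length_mul_le_wordLen k y hm
  have hyW' : (y.length : ℝ) ≤ W := by
    refine le_trans ?_ hyW
    exact_mod_cast length_le_wordLen k y
  -- Level-`k` blocks have length at least `k`, so there are few seams; this is the use of `huk`.
  have huy : (u.length : ℝ) * y.length ≤ ε * W := by
    calc (u.length : ℝ) * y.length ≤ ε * k * y.length := by gcongr
      _ = ε * (y.length * k) := by ring
      _ ≤ ε * W := by gcongr; exact hyk.trans hyW
  rw [iterate_expect_append P]
  calc _ ≤ (expect p)^[k] (fun v₁ => imageLen m k x *
        (3 * X v₁ ^ 2 + 3 * (u.length * y.length) ^ 2 + 3 * (3 * H + u.length) ^ 2)) y := by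
        refine iterate_expect_mono P fun v₁ hv₁ => iterate_expect_le_const P fun v₂ hv₂ => ?_
        rw [← hBlen, ← tailSum_const]
        refine tailSum_mono fun t _ ht => ?_
        have hv₁len := hv₁.length_eq
        refine windowDev_le hc₀ hc₁ (ht.length_le.trans hBH) (by omega) ?_ (hX v₁ hv₁)
        refine hy'.imp (fun hnil => ?_) fun hlt => by omega
        subst hnil
        exact isIterImage_nil.1 hv₂
    _ = imageLen m k x * (3 * (expect p)^[k] (fun v => X v ^ 2) y +
        3 * (u.length * y.length) ^ 2 + 3 * (3 * H + u.length) ^ 2) := by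
        simp only [iterate_expect_const_mul P, iterate_expect_add P, iterate_expect_const P]
    _ ≤ _ := by
        have h₁ : ((expect p)^[k] X y) ^ 2 ≤ (ε * W) ^ 2 := by
          have h₂ : |(expect p)^[k] X y| ≤ ε * W := hX₁.trans (by gcongr)
          exact sq_le_sq' (abs_le.1 h₂).1 (abs_le.1 h₂).2
        have h₃ : ((u.length : ℝ) * y.length) ^ 2 ≤ (ε * W) ^ 2 := by gcongr
        have h₄ : (y.length : ℝ) * (H : ℝ) ^ 2 ≤ W * (H : ℝ) ^ 2 := by gcongr
        refine mul_le_mul_of_nonneg_left ?_ (Nat.cast_nonneg _)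
        linarith

/-- The left side is the limit of mean window deviations along `ζ_m^{n+k}(a)`. Moving the last `k`
levels onto the function bounds each of these means by `K`. -/
theorem sum_windowDev_le (hm : 1 ≤ m) (P : IsPosProb p) {k : ℕ} {u : List Letter}
    {c K : ℝ} (hc₀ : 0 ≤ c) (hc₁ : c ≤ 1) {W : ℕ}
    (h : ∀ x z, (induce p)^[k] (windowDev u c W) (x :: z) ≤ imageLen m k x * K) :
    ∑ w : LegalWord m W, (occ u (List.ofFn w.1) - c * W) ^ 2 * freq p (List.ofFn w.1) ≤ K := by
  have hlim := tendsto_tailSum hm P (isLocal_windowDev u c W) (abs_windowDev_le hc₀ hc₁ W)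
  have hsum : ∀ y, tailSum ((induce p)^[k] (windowDev u c W)) y ≤ wordLen m k y * K := by
    intro y
    induction y with
    | nil => simp [tailSum]
    | cons x y ih =>
      have := h x y
      simp only [tailSum, wordLen_cons]
      push_cast
      linarith
  have hle := le_of_tendsto ((tendsto_add_atTop_iff_nat k).2 hlim) (b := K)
    (Eventually.of_forall fun n => ?_)
  · refine le_of_eq_of_le (Finset.sum_congr rfl fun w _ => ?_) hle
    have h₁ : (List.ofFn w.1).take W = List.ofFn w.1 := List.take_of_length_le (by simp)
    rw [windowDev, if_pos (by simp), h₁]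
  · have hp : (0 : ℝ) < imageLen m (n + k) Letter.a := by exact_mod_cast imageLen_pos _ _
    rw [div_le_iff₀ hp, Function.iterate_add_apply, iterate_expect_tailSum P]
    refine iterate_expect_le_const P fun v hv => (hsum v).trans ?_
    rw [hv.wordLen_eq, mul_comm]
    simp

/-- The frequency of `u` in the window of length `W` converges in mean square. -/
theorem exists_sum_sq_le (hm : 1 ≤ m) (P : IsPosProb p) (u : List Letter) {ε : ℝ} (hε : 0 < ε) :
    ∃ W₀ : ℕ, ∀ W, W₀ ≤ W → ∑ w : LegalWord m W, (occ u (List.ofFn w.1) - freq p u * W) ^ 2 *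
      freq p (List.ofFn w.1) ≤ ε * (W : ℝ) ^ 2 := by
  obtain ⟨δ, hδ, hδε⟩ : ∃ δ : ℝ, 0 < δ ∧ 6 * δ ^ 2 ≤ ε / 2 := by
    refine ⟨√(ε / 12), by positivity, ?_⟩
    rw [Real.sq_sqrt (by positivity)]
    linarith
  -- The level `k` is fixed before the window grows, so `H` is a constant and its terms, at most
  -- linear in `W`, are absorbed by `W₁`.
  obtain ⟨k, h, huk⟩ := ((eventually_abs_occ_sub_le hm P u hδ).and
    ((tendsto_natCast_atTop_atTop.const_mul_atTop hδ).eventually_ge_atTop (u.length : ℝ))).exists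
  set H : ℝ := Nat.cast (imageLen m k Letter.a) with hH
  obtain ⟨W₁, hW₁⟩ := exists_nat_ge (2 / ε * (3 * H ^ 2 + 3 * (3 * H + u.length) ^ 2))
  refine ⟨max W₁ (max 1 (imageLen m k Letter.a)), fun W hW => ?_⟩
  simp only [max_le_iff] at hW
  refine (sum_windowDev_le hm P (freq_nonneg hm P u) (freq_le_one hm P u)
    (iterate_induce_windowDev_le hm P (freq_nonneg hm P u) (freq_le_one hm P u) hδ.le huk h
      hW.2.2)).trans ?_
  have h₁ : (W₁ : ℝ) ≤ W := by exact_mod_cast hW.1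
  have h₂ : (1 : ℝ) ≤ W := by exact_mod_cast hW.2.1
  have h₃ : 3 * H ^ 2 + 3 * (3 * H + u.length) ^ 2 ≤ ε / 2 * W := by
    have := hW₁.trans h₁
    rw [div_mul_eq_mul_div, div_le_iff₀ hε] at this
    linarith
  have h₄ : 3 * (3 * H + u.length) ^ 2 ≤ 3 * (3 * H + u.length) ^ 2 * W :=
    le_mul_of_one_le_right (by positivity) h₂
  calc _ ≤ (3 * H ^ 2 + 3 * (3 * H + u.length) ^ 2) * W + 6 * δ ^ 2 * (W : ℝ) ^ 2 := by
        rw [← hH]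
        linarith
    _ ≤ ε / 2 * W * W + ε / 2 * (W : ℝ) ^ 2 := by gcongr
    _ = _ := by ring

end SecondMoment

/-! ### Legal words and the hull -/

section Hull

variable {m : ℕ}

theorem AgreesOn.getElem?_append {n : ℕ} {x : ℤ → Letter} {u v : List Letter}
    (h : AgreesOn n x u v) (hn : n ≤ u.length) {i : ℤ} (h₁ : -(n : ℤ) ≤ i) (h₂ : i < n) :
    (u ++ v)[(u.length + i).toNat]? = some (x i) := by
  rcases le_or_gt 0 i with hi | hi
  · obtain ⟨j, rfl⟩ := Int.eq_ofNat_of_zero_le hi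
    rw [List.getElem?_append_right (by omega), ← (h j (by omega)).1]
    congr 1
    omega
  · obtain ⟨j, rfl⟩ : ∃ j : ℕ, i = -(j + 1) := ⟨(-i - 1).toNat, by omega⟩
    rw [List.getElem?_append_left (by omega), ← (h j (by omega)).2,
      List.getElem?_reverse (by omega)]
    congr 1
    omega

theorem AgreesOn.le_length {n : ℕ} {x : ℤ → Letter} {u v : List Letter}
    (h : AgreesOn n x u v) : n ≤ u.length := by
  rcases n.eq_zero_or_pos with rfl | hn
  · exact Nat.zero_le _
  · obtain ⟨h', -⟩ := List.getElem?_eq_some_iff.1 (h (n - 1) (by omega)).2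
    rw [List.length_reverse] at h'
    omega

/-- Around the origin `x` agrees with a realisation `u ++ v` of a power of `ζ_m` on the legal word
`aa`. -/
theorem isLegal_of_mem_accPoints (hm : 1 ≤ m) {x : ℤ → Letter} (hx : x ∈ accPoints m) (k : ℤ)
    (n : ℕ) : IsLegal m (List.ofFn fun j : Fin n => x (k + (j : ℕ))) := by
  obtain ⟨i, -, u, v, hu, hv, h⟩ := hx (k.natAbs + n) 0
  have huv : IsLegal m (u ++ v) := (isLegal_aa hm).isIterImage
    (isIterImage_append (w₁ := [Letter.a]).2 ⟨u, v, hu, hv, rfl⟩)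
  have hle := h.le_length
  refine huv.infix ?_
  have : List.ofFn (fun j : Fin n => x (k + (j : ℕ))) =
      ((u ++ v).drop (u.length + k).toNat).take n := by
    refine List.ext_getElem? fun j => ?_
    by_cases hj : j < n
    · rw [List.getElem?_take_of_lt hj, List.getElem?_drop, List.getElem?_ofFn, dif_pos hj,
        ← h.getElem?_append hle (i := k + j) (by omega) (by omega)]
      congr 1
      omega
    · rw [List.getElem?_eq_none (by simpa using hj), List.getElem?_eq_none]
      simp only [List.length_take]
      omega
  rw [this]
  exact (List.take_prefix _ _).isInfix.trans (List.drop_suffix _ _).isInfix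

/-- All subwords of the elements of the hull are legal. -/
theorem isLegal_of_mem_hull (hm : 1 ≤ m) {x : ℤ → Letter} (hx : x ∈ hull m) (k : ℤ) (n : ℕ) :
    IsLegal m (List.ofFn fun j : Fin n => x (k + (j : ℕ))) := by
  suffices h : hull m ⊆
      {x | ∀ (k : ℤ) (n : ℕ), IsLegal m (List.ofFn fun j : Fin n => x (k + (j : ℕ)))} from h hx k n
  refine Set.sInter_subset_of_mem ⟨?_, ?_, fun x hx k n => isLegal_of_mem_accPoints hm hx k n⟩
  · simp only [Set.ofPred_forall]
    refine isClosed_iInter fun k => isClosed_iInter fun n => ?_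
    have hc : Continuous fun (x : ℤ → Letter) (j : Fin n) => x (k + (j : ℕ)) := by fun_prop
    exact (isClosed_discrete {w : Fin n → Letter | IsLegal m (List.ofFn w)}).preimage hc
  · ext x
    simp only [Set.mem_preimage, Set.mem_ofPred_eq, shift, Equiv.coe_fn_mk]
    constructor
    · intro h k n
      have h' : (fun j : Fin n => x (k + (j : ℕ))) = fun j : Fin n => x (k - 1 + (j : ℕ) + 1) :=
        funext fun j => congrArg x (by ring)
      rw [h']
      exact h (k - 1) n
    · intro h k n
      have h' : (fun j : Fin n => x (k + (j : ℕ) + 1)) = fun j : Fin n => x (k + 1 + (j : ℕ)) :=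
        funext fun j => congrArg x (by ring)
      rw [h']
      exact h (k + 1) n

theorem accPoints_subset_hull : accPoints m ⊆ hull m :=
  Set.subset_sInter fun _ hY => hY.2.2

theorem isClosed_hull : IsClosed (hull m) := isClosed_sInter fun _ hY => hY.1

instance : CompactSpace (hull m) := isCompact_iff_compactSpace.1 isClosed_hull.isCompact

theorem eventually_eq_on_finset (s : Finset ℤ) (x : ℤ → Letter) :
    ∀ᶠ y in 𝓝 x, ∀ i ∈ s, y i = x i := by
  rw [Filter.eventually_all_finset]
  intro i _
  exact (continuous_apply i).continuousAt.eventually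
    ((isOpen_discrete {x i}).mem_nhds (Set.mem_singleton _))

theorem exists_mem_hull_shift {x : ℤ → Letter} (hx : x ∈ hull m) (n : ℕ) :
    (fun i => x (i + n)) ∈ hull m := by
  induction n with
  | zero => simpa using hx
  | succ n ih =>
    rw [← shift_mem_hull] at ih
    convert ih using 1
    funext i
    simp only [shift, Equiv.coe_fn_mk]
    congr 1
    push_cast
    ring

/-- The two-sided sequence that continues the marked word `u|v`. -/
def extend (u v : List Letter) (i : ℤ) : Letter :=
  if 0 ≤ i then v.getD i.toNat Letter.a else u.reverse.getD (-i - 1).toNat Letter.a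

theorem agreesOn_extend {n : ℕ} {u v : List Letter} (hu : n ≤ u.length) (hv : n ≤ v.length) :
    AgreesOn n (extend u v) u v := by
  intro j hj
  have h₁ : (-(-((j : ℤ) + 1)) - 1).toNat = j := by omega
  rw [extend, extend, if_pos (by omega), if_neg (by omega), h₁, Int.toNat_natCast]
  simp [List.getD_eq_getElem?_getD, hj.trans_le hv, hj.trans_le hu]

/-- Every realisation of `ζ_m^k(a)` is the beginning of the right half of an accumulation point. -/
theorem exists_mem_accPoints (hm : 1 ≤ m) {k : ℕ} {v : List Letter}
    (hv : IsIterImage m k [Letter.a] v) :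
    ∃ x ∈ accPoints m, ∀ j : ℕ, j < v.length → v[j]? = some (x j) := by
  choose V hV hvV using hv.exists_prefix hm
  have hlen : ∀ n, n ≤ (V n).length := fun n => by
    have := lt_imageLen_a hm (n + k)
    rw [(hV n).length_eq]
    simp
    omega
  -- All `V n` begin with `v` and their lengths tend to infinity, so a cluster point keeps `v` and
  -- ignores the padding letter of `extend`.
  obtain ⟨x, hx⟩ := exists_clusterPt_of_compactSpace (map (fun n => extend (V n) (V n)) atTop)
  have hfreq : ∀ N K : ℕ, ∃ n, K ≤ n ∧ N ≤ n ∧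
      ∀ i : ℤ, -(N : ℤ) ≤ i → i < N → extend (V n) (V n) i = x i := by
    intro N K
    obtain ⟨n, hn, h⟩ := (frequently_atTop.1 (mapClusterPt_iff_frequently.1 hx _
      (eventually_eq_on_finset (Finset.Ico (-(N : ℤ)) N) x))) (max K N)
    exact ⟨n, (le_max_left _ _).trans hn, (le_max_right _ _).trans hn,
      fun i h₁ h₂ => h i (Finset.mem_Ico.2 ⟨h₁, h₂⟩)⟩
  refine ⟨x, fun N K => ?_, fun j hj => ?_⟩
  · obtain ⟨n, hK, hN, h⟩ := hfreq N K
    refine ⟨n + k, by omega, V n, V n, hV n, hV n, fun j hj => ?_⟩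
    have := agreesOn_extend (hN.trans (hlen n)) (hN.trans (hlen n)) j hj
    rwa [h _ (by omega) (by omega), h _ (by omega) (by omega)] at this
  · obtain ⟨n, -, hN, h⟩ := hfreq v.length 0
    have := (agreesOn_extend (hN.trans (hlen n)) (hN.trans (hlen n)) j hj).1
    rw [h _ (by omega) (by omega)] at this
    obtain ⟨t, ht⟩ := hvV n
    rw [← this, ← ht, List.getElem?_append_left hj]

/-- Every legal word occurs in the hull. -/
theorem IsLegal.exists_mem_hull (hm : 1 ≤ m) {v : List Letter} (hv : IsLegal m v) :
    ∃ x ∈ hull m, ∀ j : ℕ, j < v.length → v[j]? = some (x j) := by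
  obtain ⟨k, hk, _, hw, s, t, rfl⟩ := hv
  obtain ⟨k, rfl⟩ : ∃ j, k = j + 1 := ⟨k - 1, by omega⟩
  obtain ⟨x, hx, h⟩ := exists_mem_accPoints hm (isIterImage_succ_b.1 hw)
  refine ⟨_, exists_mem_hull_shift (accPoints_subset_hull hx) s.length, fun j hj => ?_⟩
  have := h (s.length + j) (by simp; omega)
  rw [List.append_assoc, List.getElem?_append_right (by omega), Nat.add_sub_cancel_left,
    List.getElem?_append_left hj] at this
  rw [this]
  push_cast
  rw [add_comm]

end Hull

/-! ### The pointwise ergodic theorem for ergodic transformations -/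

section Birkhoff

variable {α : Type*} {T : α → α}

/-- The maximum of the first `n` Birkhoff sums and `0`. -/
def maxBirkhoff (T : α → α) (f : α → ℝ) : ℕ → α → ℝ
  | 0, _ => 0
  | n + 1, x => max 0 (f x + maxBirkhoff T f n (T x))

theorem maxBirkhoff_nonneg (f : α → ℝ) (n : ℕ) (x : α) : 0 ≤ maxBirkhoff T f n x := by
  cases n with
  | zero => exact le_rfl
  | succ n => exact le_max_left _ _

theorem maxBirkhoff_le_succ (f : α → ℝ) (n : ℕ) (x : α) :
    maxBirkhoff T f n x ≤ maxBirkhoff T f (n + 1) x := by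
  induction n generalizing x with
  | zero => exact maxBirkhoff_nonneg f 1 x
  | succ n ih => exact max_le_max le_rfl (add_le_add_right (ih (T x)) _)

theorem birkhoffSum_le_maxBirkhoff (f : α → ℝ) (n : ℕ) (x : α) :
    birkhoffSum T f n x ≤ maxBirkhoff T f n x := by
  induction n generalizing x with
  | zero => simp [maxBirkhoff]
  | succ n ih =>
    rw [birkhoffSum_succ']
    exact (add_le_add_right (ih (T x)) _).trans (le_max_right _ _)

variable [MeasurableSpace α] {μ : Measure α}

theorem measurable_maxBirkhoff (hT : Measurable T) {f : α → ℝ} (hf : Measurable f) (n : ℕ) :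
    Measurable (maxBirkhoff T f n) := by
  induction n with
  | zero => exact measurable_const
  | succ n ih => exact measurable_const.max (hf.add (ih.comp hT))

theorem integrable_maxBirkhoff (hT : MeasurePreserving T μ μ) {f : α → ℝ}
    (hf : Integrable f μ) (n : ℕ) : Integrable (maxBirkhoff T f n) μ := by
  induction n with
  | zero => exact integrable_zero α ℝ μ
  | succ n ih =>
    exact (integrable_zero α ℝ μ).sup (hf.add (hT.integrable_comp_of_integrable ih))

/-- If `∫ f < 0`, then the Birkhoff sums of `f` are almost everywhere bounded above. -/
theorem ae_bddAbove_birkhoffSum (hT : Ergodic T μ) {f : α → ℝ} (hfm : Measurable f)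
    (hf : Integrable f μ) (hneg : ∫ x, f x ∂μ < 0) :
    ∀ᵐ x ∂μ, ∃ K : ℝ, ∀ n, birkhoffSum T f n x ≤ K := by
  set F := maxBirkhoff T f with hF
  set A : Set α := {x | ∀ K : ℕ, ∃ n, (K : ℝ) < F n x} with hA
  have hFmono : ∀ x, Monotone fun n => F n x := fun x =>
    monotone_nat_of_le_succ fun n => maxBirkhoff_le_succ f n x
  have hAm : MeasurableSet A := by
    have : A = ⋂ K : ℕ, ⋃ n : ℕ, {x | (K : ℝ) < F n x} := by
      ext x
      simp [hA]
    rw [this]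
    exact MeasurableSet.iInter fun K => MeasurableSet.iUnion fun n =>
      measurableSet_lt measurable_const (measurable_maxBirkhoff hT.measurable hfm n)
  -- `A` is where the maximal sums are unbounded; passing from `x` to `T x` alters them by the
  -- finite amount `f x` only.
  have hAT : T ⁻¹' A = A := by
    ext x
    constructor
    · intro h K
      obtain ⟨K', hK'⟩ := exists_nat_ge ((K : ℝ) - f x)
      obtain ⟨n, hn⟩ := h K'
      exact ⟨n + 1, lt_of_lt_of_le (by linarith) (le_max_right 0 (f x + F n (T x)))⟩
    · intro h K
      obtain ⟨K', hK'⟩ := exists_nat_ge (max 0 (f x + K))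
      obtain ⟨n, hn⟩ := h K'
      refine ⟨n, ?_⟩
      have h₁ : max 0 (f x + K) < max 0 (f x + F n (T x)) :=
        (hK'.trans_lt hn).trans_le (maxBirkhoff_le_succ f n x)
      rcases lt_max_iff.1 h₁ with h₂ | h₂
      · exact absurd (le_max_left _ _) (not_le.2 h₂)
      · linarith [le_max_right 0 (f x + K)]
  rcases hT.toPreErgodic.ae_empty_or_univ hAm hAT with h | h
  · filter_upwards [h.mem_iff] with x hx
    have hx' : x ∉ A := fun hxA => hx.1 hxA
    simp only [hA, Set.mem_ofPred_eq, not_forall, not_exists, not_lt] at hx'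
    obtain ⟨K, hK⟩ := hx'
    exact ⟨K, fun n => (birkhoffSum_le_maxBirkhoff f n x).trans (hK n)⟩
  · exfalso
    -- If `A` has full measure, the maximum with `0` is eventually inactive and the integrand
    -- becomes `f`. But each integral equals `∫ (F (n + 1) - F n) ≥ 0` by invariance, contradicting
    -- `∫ f < 0`.
    have hlim : Tendsto (fun n => ∫ x, (F (n + 1) x - F n (T x)) ∂μ) atTop (𝓝 (∫ x, f x ∂μ)) := by
      refine tendsto_integral_of_dominated_convergence (fun x => |f x|) (fun n => ?_) hf.abs
        (fun n => Eventually.of_forall fun x => ?_) ?_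
      · exact ((measurable_maxBirkhoff hT.measurable hfm (n + 1)).sub
          ((measurable_maxBirkhoff hT.measurable hfm n).comp hT.measurable)).aestronglyMeasurable
      · have h₁ : F (n + 1) x = max 0 (f x + F n (T x)) := rfl
        have h₂ : 0 ≤ F n (T x) := maxBirkhoff_nonneg f n (T x)
        rw [h₁, Real.norm_eq_abs, abs_le]
        constructor
        · linarith [le_max_right 0 (f x + F n (T x)), neg_abs_le (f x)]
        · rw [sub_le_iff_le_add]
          exact max_le (by positivity) (by linarith [le_abs_self (f x)])
      · filter_upwards [h.mem_iff] with x hx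
        have hxA : T x ∈ A := by
          rw [← Set.mem_preimage, hAT]
          exact hx.2 trivial
        obtain ⟨K, hK⟩ := exists_nat_ge (-f x)
        obtain ⟨N, hN⟩ := hxA K
        refine tendsto_const_nhds.congr' ?_
        filter_upwards [eventually_ge_atTop N] with n hn
        have h₁ : F (n + 1) x = max 0 (f x + F n (T x)) := rfl
        have h₂ : F N (T x) ≤ F n (T x) := hFmono (T x) hn
        rw [h₁, max_eq_right (by linarith)]
        ring
    refine absurd (ge_of_tendsto' hlim fun n => ?_) (not_le.2 hneg)
    have h₁ := integrable_maxBirkhoff hT.toMeasurePreserving hf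
    have h₂ : ∫ x, F n (T x) ∂μ = ∫ x, F n x ∂μ := by
      have := integral_map (μ := μ) hT.measurable.aemeasurable (f := F n)
        (measurable_maxBirkhoff hT.measurable hfm n).aestronglyMeasurable
      rw [← this, hT.toMeasurePreserving.map_eq]
    have h₃ : Integrable (fun x => F n (T x)) μ :=
      hT.toMeasurePreserving.integrable_comp_of_integrable (h₁ n)
    rw [integral_sub (h₁ _) h₃, h₂, sub_nonneg]
    exact integral_mono (h₁ _) (h₁ _) (maxBirkhoff_le_succ f n)

/-- For `∫ f < d < c` the Birkhoff sums of `f - d` are bounded above almost everywhere. -/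
theorem ae_eventually_birkhoffSum_le [IsProbabilityMeasure μ] (hT : Ergodic T μ) {f : α → ℝ}
    (hfm : Measurable f) (hf : Integrable f μ) {c : ℝ} (hc : ∫ x, f x ∂μ < c) :
    ∀ᵐ x ∂μ, ∀ᶠ n : ℕ in atTop, birkhoffSum T f n x / n < c := by
  obtain ⟨d, hd, hdc⟩ := exists_between hc
  have hneg : ∫ x, (f x - d) ∂μ < 0 := by
    rw [integral_sub hf (integrable_const d)]
    simpa using hd
  filter_upwards [ae_bddAbove_birkhoffSum hT (hfm.sub_const d) (hf.sub (integrable_const d)) hneg]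
    with x ⟨K, hK⟩
  have hlim : Tendsto (fun n : ℕ => d + K / (n : ℝ)) atTop (𝓝 (d + 0)) :=
    tendsto_const_nhds.add (tendsto_natCast_atTop_atTop.const_div_atTop K)
  rw [add_zero] at hlim
  filter_upwards [hlim.eventually_lt_const hdc, eventually_gt_atTop 0] with n hn hn0
  refine lt_of_le_of_lt ?_ hn
  have hn' : (0 : ℝ) < n := by exact_mod_cast hn0
  have := hK n
  simp only [birkhoffSum, Finset.sum_sub_distrib, Finset.sum_const, Finset.card_range,
    nsmul_eq_mul] at this
  rw [div_le_iff₀ hn', birkhoffSum]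
  have h₁ : (d + K / n) * n = n * d + K := by
    field_simp
  linarith

theorem ae_tendsto_birkhoff_of_measurable [IsProbabilityMeasure μ] (hT : Ergodic T μ) {f : α → ℝ}
    (hfm : Measurable f) (hf : Integrable f μ) :
    ∀ᵐ x ∂μ, Tendsto (fun n : ℕ => birkhoffSum T f n x / n) atTop (𝓝 (∫ x, f x ∂μ)) := by
  have h₁ : ∀ᵐ x ∂μ, ∀ j : ℕ, ∀ᶠ n : ℕ in atTop,
      birkhoffSum T f n x / n < ∫ x, f x ∂μ + 1 / (j + 1 : ℝ) :=
    ae_all_iff.2 fun j => ae_eventually_birkhoffSum_le hT hfm hf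
      (lt_add_of_pos_right _ Nat.one_div_pos_of_nat)
  have h₂ : ∀ᵐ x ∂μ, ∀ j : ℕ, ∀ᶠ n : ℕ in atTop,
      birkhoffSum T (fun x => -f x) n x / n < -∫ x, f x ∂μ + 1 / (j + 1 : ℝ) :=
    ae_all_iff.2 fun j => ae_eventually_birkhoffSum_le hT hfm.neg hf.neg (by
      change ∫ x, -f x ∂μ < _
      rw [integral_neg]
      exact lt_add_of_pos_right _ Nat.one_div_pos_of_nat)
  filter_upwards [h₁, h₂] with x hx₁ hx₂
  refine Metric.tendsto_nhds.2 fun ε hε => ?_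
  obtain ⟨j, hj⟩ := exists_nat_one_div_lt hε
  filter_upwards [hx₁ j, hx₂ j] with n hn₁ hn₂
  have h₃ : birkhoffSum T (fun x => -f x) n x = -birkhoffSum T f n x := by
    simp [birkhoffSum]
  rw [h₃, neg_div] at hn₂
  rw [Real.dist_eq, abs_lt]
  constructor <;> linarith

/-- The pointwise ergodic theorem for ergodic measure-preserving transformations. -/
theorem ae_tendsto_birkhoff [IsProbabilityMeasure μ] (hT : Ergodic T μ) {f : α → ℝ}
    (hf : Integrable f μ) :
    ∀ᵐ x ∂μ, Tendsto (fun n : ℕ => birkhoffSum T f n x / n) atTop (𝓝 (∫ x, f x ∂μ)) := by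
  have hfm := hf.1.aemeasurable
  have hae := hfm.ae_eq_mk
  have h₁ := ae_tendsto_birkhoff_of_measurable hT hfm.measurable_mk (hf.congr hae)
  have h₂ : ∀ᵐ x ∂μ, ∀ n : ℕ, f (T^[n] x) = hfm.mk f (T^[n] x) :=
    ae_all_iff.2 fun n => (hT.toMeasurePreserving.iterate n).quasiMeasurePreserving.ae hae
  filter_upwards [h₁, h₂] with x hx₁ hx₂
  rw [integral_congr_ae hae]
  refine hx₁.congr fun n => ?_
  simp only [birkhoffSum, hx₂]

theorem ae_tendsto_birkhoff_complex [IsProbabilityMeasure μ] (hT : Ergodic T μ) {f : α → ℂ}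
    (hf : Integrable f μ) :
    ∀ᵐ x ∂μ, Tendsto (fun n : ℕ => birkhoffSum T f n x / n) atTop (𝓝 (∫ x, f x ∂μ)) := by
  filter_upwards [ae_tendsto_birkhoff hT hf.re, ae_tendsto_birkhoff hT hf.im] with x hre him
  have h := ((Complex.continuous_ofReal.tendsto _).comp hre).add
    (((Complex.continuous_ofReal.tendsto _).comp him).mul_const Complex.I)
  have hint : ((∫ x, RCLike.re (f x) ∂μ : ℝ) : ℂ) + ((∫ x, RCLike.im (f x) ∂μ : ℝ) : ℂ) * Complex.I
      = ∫ x, f x ∂μ := integral_re_add_im hf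
  rw [hint] at h
  refine h.congr fun n => ?_
  apply Complex.ext <;> simp [birkhoffSum, Complex.div_natCast_re, Complex.div_natCast_im]

/-- The pointwise ergodic theorem for an invertible transformation, with averages over the integer
interval `[s, N + s - 1]`. -/
theorem ae_tendsto_average_Icc [IsProbabilityMeasure μ] {T : Equiv.Perm α} (hT : Ergodic T μ)
    (hT' : Measurable T.symm) {f : α → ℂ} (hf : Integrable f μ) (s : ℤ) :
    ∀ᵐ x ∂μ, Tendsto (fun N : ℕ => (1 / (N : ℂ)) *
      ∑ i ∈ Finset.Icc s ((N : ℤ) + s - 1), f ((T ^ i) x)) atTop (𝓝 (∫ y, f y ∂μ)) := by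
  let e : α ≃ᵐ α := ⟨T, hT.measurable, hT'⟩
  have hinv : MeasurePreserving T.symm μ μ := MeasurePreserving.symm e hT.toMeasurePreserving
  have hpow : MeasurePreserving (T ^ s : Equiv.Perm α) μ μ := by
    obtain ⟨n, rfl | rfl⟩ := s.eq_nat_or_neg
    · rw [zpow_natCast, Equiv.Perm.coe_pow]
      exact hT.toMeasurePreserving.iterate n
    · rw [zpow_neg, zpow_natCast, ← inv_pow, Equiv.Perm.coe_pow]
      exact hinv.iterate n
  -- The average over `[s, N + s - 1]` at `x` is the usual one at `T ^ s x`.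
  filter_upwards [hpow.quasiMeasurePreserving.ae (ae_tendsto_birkhoff_complex hT hf)] with x hx
  refine hx.congr fun N => ?_
  rw [div_eq_inv_mul, one_div, birkhoffSum]
  congr 1
  refine Finset.sum_bij (fun j _ => (j : ℤ) + s) ?_ ?_ ?_ ?_
  · intro j hj
    simp only [Finset.mem_range, Finset.mem_Icc] at hj ⊢
    omega
  · intro j _ j' _ h
    simpa using h
  · intro i hi
    simp only [Finset.mem_Icc] at hi
    exact ⟨(i - s).toNat, by simp; omega, by omega⟩
  · intro j _
    rw [zpow_add, zpow_natCast, Equiv.Perm.mul_apply, Equiv.Perm.coe_pow]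

end Birkhoff

/-! ### Ergodicity from mean square convergence on a π-system -/

section MeanSquare

variable {α : Type*} {T : α → α} {B : Set α}

theorem birkhoffSum_indicator_nonneg (N : ℕ) (x : α) :
    0 ≤ birkhoffSum T (B.indicator fun _ => (1 : ℝ)) N x :=
  Finset.sum_nonneg fun _ _ => Set.indicator_nonneg (fun _ _ => zero_le_one) _

theorem birkhoffSum_indicator_le (N : ℕ) (x : α) :
    birkhoffSum T (B.indicator fun _ => (1 : ℝ)) N x ≤ N := by
  calc _ ≤ ∑ _i ∈ Finset.range N, (1 : ℝ) := Finset.sum_le_sum fun i _ =>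
        Set.indicator_le_self' (fun _ _ => zero_le_one' ℝ) (T^[i] x)
    _ = N := by simp

variable [MeasurableSpace α]

/-- The deviation of the number of visits to `B` before time `N` from `N * μ B`. -/
def visitDev (μ : Measure α) (T : α → α) (B : Set α) (N : ℕ) (x : α) : ℝ :=
  birkhoffSum T (B.indicator fun _ => (1 : ℝ)) N x - μ.real B * N

/-- The mean square convergence of the frequency of visits to `B`. -/
def HasMeanFreq (μ : Measure α) (T : α → α) (B : Set α) : Prop :=
  ∀ ε : ℝ, 0 < ε → ∃ N₀ : ℕ, ∀ N, N₀ ≤ N → ∫ x, visitDev μ T B N x ^ 2 ∂μ ≤ ε * (N : ℝ) ^ 2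

variable {μ : Measure α}

theorem measurable_birkhoffSum_indicator (hT : Measurable T) (hB : MeasurableSet B) (N : ℕ) :
    Measurable (birkhoffSum T (B.indicator fun _ => (1 : ℝ)) N) := by
  unfold birkhoffSum
  exact Finset.measurable_sum _ fun i _ => (measurable_const.indicator hB).comp (hT.iterate i)

theorem hasMeanFreq_empty : HasMeanFreq μ T ∅ := fun ε hε => ⟨0, fun N _ => by
  simp [visitDev, birkhoffSum]
  positivity⟩

variable [IsProbabilityMeasure μ]

theorem abs_visitDev_le (N : ℕ) (x : α) : |visitDev μ T B N x| ≤ N := by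
  have h₁ : μ.real B * N ≤ N := mul_le_of_le_one_left (Nat.cast_nonneg _) measureReal_le_one
  have h₂ : 0 ≤ μ.real B * N := by positivity
  have h₃ := birkhoffSum_indicator_nonneg (T := T) (B := B) N x
  have h₄ := birkhoffSum_indicator_le (T := T) (B := B) N x
  rw [visitDev, abs_le]
  constructor <;> linarith

theorem integrable_visitDev_sq (hT : Measurable T) (hB : MeasurableSet B) (N : ℕ) :
    Integrable (fun x => visitDev μ T B N x ^ 2) μ := by
  refine Integrable.of_bound (C := (N : ℝ) ^ 2)
    (((measurable_birkhoffSum_indicator hT hB N).sub_const _).pow_const 2).aestronglyMeasurable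
    (Eventually.of_forall fun x => ?_)
  rw [Real.norm_eq_abs, abs_pow]
  gcongr
  exact abs_visitDev_le N x

theorem integral_birkhoffSum_indicator (hT : MeasurePreserving T μ μ) (hB : MeasurableSet B)
    (N : ℕ) : Integrable (birkhoffSum T (B.indicator fun _ => (1 : ℝ)) N) μ ∧
      ∫ x, birkhoffSum T (B.indicator fun _ => (1 : ℝ)) N x ∂μ = N * μ.real B := by
  have hint : Integrable (B.indicator fun _ => (1 : ℝ)) μ := (integrable_const 1).indicator hB
  have h₁ : ∀ i : ℕ, Integrable (fun x => B.indicator (fun _ => (1 : ℝ)) (T^[i] x)) μ :=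
    fun i => (hT.iterate i).integrable_comp_of_integrable hint
  have h₂ : ∀ i : ℕ, ∫ x, B.indicator (fun _ => (1 : ℝ)) (T^[i] x) ∂μ = μ.real B := by
    intro i
    have := integral_map (μ := μ) (hT.iterate i).measurable.aemeasurable
      (f := B.indicator fun _ => (1 : ℝ)) (measurable_const.indicator hB).aestronglyMeasurable
    rw [← this, (hT.iterate i).map_eq, integral_indicator_const _ hB]
    simp
  constructor
  · exact integrable_finsetSum _ fun i _ => h₁ i
  · simp only [birkhoffSum]
    rw [integral_finsetSum _ fun i _ => h₁ i]
    simp [h₂]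

/-- A set of small measure has a small mean square deviation. -/
theorem integral_visitDev_sq_le (hT : MeasurePreserving T μ μ) (hB : MeasurableSet B) (N : ℕ) :
    ∫ x, visitDev μ T B N x ^ 2 ∂μ ≤ 2 * μ.real B * (N : ℝ) ^ 2 := by
  obtain ⟨h₁, h₂⟩ := integral_birkhoffSum_indicator hT hB N
  have h₃ : Integrable (fun x => (N : ℝ) * (birkhoffSum T (B.indicator fun _ => (1 : ℝ)) N x +
      μ.real B * N)) μ := (h₁.add (integrable_const _)).const_mul _
  calc _ ≤ ∫ x, (N : ℝ) * (birkhoffSum T (B.indicator fun _ => (1 : ℝ)) N x + μ.real B * N) ∂μ := by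
        refine integral_mono (integrable_visitDev_sq hT.measurable hB N) h₃ fun x => ?_
        have h₄ := birkhoffSum_indicator_nonneg (T := T) (B := B) N x
        have h₅ : 0 ≤ μ.real B * N := by positivity
        have h₆ : |visitDev μ T B N x| ≤
            birkhoffSum T (B.indicator fun _ => (1 : ℝ)) N x + μ.real B * N := by
          rw [visitDev, abs_le]
          constructor <;> linarith
        calc visitDev μ T B N x ^ 2 = |visitDev μ T B N x| * |visitDev μ T B N x| := by
              rw [abs_mul_abs_self, sq]
          _ ≤ _ := mul_le_mul (abs_visitDev_le N x) h₆ (abs_nonneg _) (Nat.cast_nonneg _)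
    _ = _ := by
        rw [integral_const_mul, integral_add h₁ (integrable_const _), h₂]
        simp
        ring

theorem HasMeanFreq.compl (hB : MeasurableSet B) (h : HasMeanFreq μ T B) :
    HasMeanFreq μ T Bᶜ := by
  have hdev : ∀ N x, visitDev μ T Bᶜ N x = -visitDev μ T B N x := by
    intro N x
    have h₁ : ∀ y, Bᶜ.indicator (fun _ => (1 : ℝ)) y = 1 - B.indicator (fun _ => (1 : ℝ)) y := by
      intro y
      by_cases hy : y ∈ B <;> simp [hy]
    simp only [visitDev, birkhoffSum, h₁, Finset.sum_sub_distrib, probReal_compl_eq_one_sub hB]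
    simp
    ring
  intro ε hε
  obtain ⟨N₀, hN₀⟩ := h ε hε
  exact ⟨N₀, fun N hN => by simpa only [hdev, neg_sq] using hN₀ N hN⟩

/-- A tail of the union has small measure, hence uniformly small mean square deviation by
`integral_visitDev_sq_le`; the finitely many other sets are combined by Cauchy–Schwarz. -/
theorem HasMeanFreq.iUnion (hT : MeasurePreserving T μ μ) {f : ℕ → Set α}
    (hd : Pairwise (Function.onFun Disjoint f)) (hf : ∀ i, MeasurableSet (f i))
    (h : ∀ i, HasMeanFreq μ T (f i)) : HasMeanFreq μ T (⋃ i, f i) := by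
  intro ε hε
  have htail : Tendsto (fun K => ∑' i, μ (f (i + K))) atTop (𝓝 0) := by
    refine ENNReal.tendsto_sum_nat_add (fun i => μ (f i)) ?_
    rw [← measure_iUnion hd hf]
    exact measure_ne_top μ _
  obtain ⟨K, hK⟩ := (htail.eventually_lt_const
    (ENNReal.ofReal_pos.2 (by positivity : 0 < ε / 8))).exists
  set R : Set α := ⋃ i, f (i + K) with hR
  have hRm : MeasurableSet R := MeasurableSet.iUnion fun i => hf _
  have hμR : μ.real R ≤ ε / 8 :=
    ENNReal.toReal_le_of_le_ofReal (by positivity) ((measure_iUnion_le _).trans hK.le)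
  have hind : ∀ y, (⋃ i, f i).indicator (fun _ => (1 : ℝ)) y =
      ∑ i ∈ Finset.range K, (f i).indicator (fun _ => (1 : ℝ)) y +
        R.indicator (fun _ => (1 : ℝ)) y := by
    intro y
    by_cases hy : ∃ i, y ∈ f i
    · obtain ⟨i, hi⟩ := hy
      have huniq : ∀ j, y ∈ f j → j = i := fun j hj => by
        by_contra hne
        exact Set.disjoint_left.1 (hd hne) hj hi
      rw [Set.indicator_of_mem (Set.mem_iUnion.2 ⟨i, hi⟩)]
      rcases lt_or_ge i K with hiK | hiK
      · rw [Finset.sum_eq_single_of_mem i (Finset.mem_range.2 hiK) fun j _ hj =>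
          Set.indicator_of_notMem (fun hyj => hj (huniq j hyj)) _, Set.indicator_of_mem hi,
          Set.indicator_of_notMem, add_zero]
        rintro ⟨_, ⟨j, rfl⟩, hj⟩
        have := huniq _ hj
        omega
      · rw [Finset.sum_eq_zero fun j hj => Set.indicator_of_notMem (fun hyj => ?_) _,
          Set.indicator_of_mem, zero_add]
        · exact Set.mem_iUnion.2 ⟨i - K, by rwa [Nat.sub_add_cancel hiK]⟩
        · have := huniq j hyj
          have := Finset.mem_range.1 hj
          omega
    · push Not at hy
      have hyR : y ∉ R := by
        rw [hR, Set.mem_iUnion]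
        exact fun ⟨i, hi⟩ => hy _ hi
      rw [Set.indicator_of_notMem (by simpa using hy), Finset.sum_eq_zero fun j _ =>
        Set.indicator_of_notMem (hy j) _, Set.indicator_of_notMem hyR, add_zero]
  have hμ : μ.real (⋃ i, f i) = ∑ i ∈ Finset.range K, μ.real (f i) + μ.real R := by
    have h₁ : ∀ i, Integrable ((f i).indicator fun _ => (1 : ℝ)) μ :=
      fun i => (integrable_const 1).indicator (hf i)
    have h₂ := integral_indicator_one (μ := μ) (MeasurableSet.iUnion hf)
    rw [← h₂]
    calc _ = ∫ y, (∑ i ∈ Finset.range K, (f i).indicator (fun _ => (1 : ℝ)) y +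
          R.indicator (fun _ => (1 : ℝ)) y) ∂μ := integral_congr_ae (Eventually.of_forall hind)
      _ = _ := by
        rw [integral_add (integrable_finsetSum _ fun i _ => h₁ i)
          ((integrable_const 1).indicator hRm), integral_finsetSum _ fun i _ => h₁ i]
        simp [integral_indicator_const, hf, hRm]
  have hdev : ∀ N x, visitDev μ T (⋃ i, f i) N x =
      ∑ i ∈ Finset.range K, visitDev μ T (f i) N x + visitDev μ T R N x := by
    intro N x
    simp only [visitDev, birkhoffSum, hind, hμ, Finset.sum_add_distrib, Finset.sum_sub_distrib,
      add_mul, Finset.sum_mul]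
    rw [Finset.sum_comm]
    ring
  -- Cauchy–Schwarz costs a factor `2 K²` in total, so these sets contribute at most `ε / 2`; the
  -- tail contributes `2 * 2 * (ε / 8)`.
  have hδ : 0 < ε / (4 * (K + 1) ^ 2) := by positivity
  choose N₀ hN₀ using fun i => h i _ hδ
  refine ⟨∑ i ∈ Finset.range K, N₀ i, fun N hN => ?_⟩
  have hint := fun i => integrable_visitDev_sq (μ := μ) hT.measurable (hf i) N
  have hintR := integrable_visitDev_sq (μ := μ) hT.measurable hRm N
  have hintS : Integrable (fun x => ∑ i ∈ Finset.range K, visitDev μ T (f i) N x ^ 2) μ :=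
    integrable_finsetSum _ fun i _ => hint i
  calc _ ≤ ∫ x, (2 * K * ∑ i ∈ Finset.range K, visitDev μ T (f i) N x ^ 2 +
        2 * visitDev μ T R N x ^ 2) ∂μ := by
        refine integral_mono (integrable_visitDev_sq hT.measurable (MeasurableSet.iUnion hf) N)
          ((hintS.const_mul _).add (hintR.const_mul _)) fun x => ?_
        have h₁ := sq_sum_le_card_mul_sum_sq (s := Finset.range K)
          (f := fun i => visitDev μ T (f i) N x)
        rw [Finset.card_range] at h₁
        simp only [hdev]
        nlinarith [sq_nonneg (∑ i ∈ Finset.range K, visitDev μ T (f i) N x - visitDev μ T R N x)]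
    _ = 2 * K * ∑ i ∈ Finset.range K, ∫ x, visitDev μ T (f i) N x ^ 2 ∂μ +
        2 * ∫ x, visitDev μ T R N x ^ 2 ∂μ := by
        rw [integral_add (hintS.const_mul _) (hintR.const_mul _), integral_const_mul,
          integral_const_mul, integral_finsetSum _ fun i _ => hint i]
    _ ≤ 2 * K * ∑ i ∈ Finset.range K, ε / (4 * (K + 1) ^ 2) * (N : ℝ) ^ 2 +
        2 * (2 * (ε / 8) * (N : ℝ) ^ 2) := by
        gcongr with i hi
        · exact hN₀ i N ((Finset.single_le_sum (fun _ _ => Nat.zero_le _) hi).trans hN)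
        · exact (integral_visitDev_sq_le hT hRm N).trans (by gcongr)
    _ ≤ _ := by
        have h₁ : (K : ℝ) * K / (K + 1) ^ 2 ≤ 1 := by
          rw [div_le_one (by positivity)]
          nlinarith [(Nat.cast_nonneg K : (0 : ℝ) ≤ K)]
        have h₂ : 2 * K * ∑ i ∈ Finset.range K, ε / (4 * (K + 1) ^ 2) * (N : ℝ) ^ 2 =
            (K : ℝ) * K / (K + 1) ^ 2 * (ε / 2 * (N : ℝ) ^ 2) := by
          rw [Finset.sum_const, Finset.card_range, nsmul_eq_mul]
          field_simp
          ring
        rw [h₂]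
        have h₃ : 0 ≤ ε / 2 * (N : ℝ) ^ 2 := by positivity
        nlinarith [mul_le_of_le_one_left h₃ h₁]

/-- A measure-preserving transformation is ergodic if the frequency of visits converges in mean
square for the elements of a generating π-system. -/
theorem ergodic_of_hasMeanFreq {C : Set (Set α)} (hT : MeasurePreserving T μ μ)
    (hgen : ‹MeasurableSpace α› = MeasurableSpace.generateFrom C) (hpi : IsPiSystem C)
    (h : ∀ B ∈ C, HasMeanFreq μ T B) : Ergodic T μ := by
  have hall : ∀ B, MeasurableSet B → HasMeanFreq μ T B := fun B hB =>
    MeasurableSpace.induction_on_inter (C := fun B _ => HasMeanFreq μ T B) hgen hpi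
      hasMeanFreq_empty h (fun B hB hB' => hB'.compl hB)
      (fun f hd hf hf' => HasMeanFreq.iUnion hT hd hf hf') B hB
  refine ⟨hT, ⟨fun s hs hTs => ?_⟩⟩
  have hinv : ∀ (i : ℕ) x, T^[i] x ∈ s ↔ x ∈ s := by
    intro i
    induction i with
    | zero => simp
    | succ i ih =>
      intro x
      rw [Function.iterate_succ_apply, ih, ← Set.mem_preimage, hTs]
  set c := μ.real s with hc
  -- For an invariant set the deviation does not average out: its mean square is `N² c (1 - c)`, so
  -- mean square convergence forces `c` to be `0` or `1`.
  have hdev : ∀ N x, visitDev μ T s N x = N * (s.indicator (fun _ => (1 : ℝ)) x - c) := by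
    intro N x
    have : ∀ i, s.indicator (fun _ => (1 : ℝ)) (T^[i] x) = s.indicator (fun _ => (1 : ℝ)) x := by
      intro i
      by_cases hx : x ∈ s
      · rw [Set.indicator_of_mem hx, Set.indicator_of_mem ((hinv i x).2 hx)]
      · rw [Set.indicator_of_notMem hx, Set.indicator_of_notMem fun h => hx ((hinv i x).1 h)]
    simp only [visitDev, birkhoffSum, this]
    simp
    ring
  have hval : ∫ x, (s.indicator (fun _ => (1 : ℝ)) x - c) ^ 2 ∂μ = c * (1 - c) := by
    have h₁ : ∀ x, (s.indicator (fun _ => (1 : ℝ)) x - c) ^ 2 =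
        (1 - 2 * c) * s.indicator (fun _ => (1 : ℝ)) x + c ^ 2 := by
      intro x
      by_cases hx : x ∈ s <;> simp [hx]
      ring
    simp only [h₁]
    rw [integral_add (((integrable_const 1).indicator hs).const_mul _) (integrable_const _),
      integral_const_mul, integral_indicator_const _ hs]
    simp [← hc]
    ring
  have hzero : c * (1 - c) ≤ 0 := by
    refine le_of_forall_pos_le_add fun ε hε => ?_
    obtain ⟨N₀, hN₀⟩ := hall s hs ε hε
    have h₁ := hN₀ (N₀ + 1) (Nat.le_succ _)
    simp only [hdev, mul_pow] at h₁
    rw [integral_const_mul, hval, mul_comm ε] at h₁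
    rw [zero_add]
    exact le_of_mul_le_mul_left h₁ (by positivity)
  have hc₀ : 0 ≤ c := measureReal_nonneg
  have hc₁ : c ≤ 1 := measureReal_le_one
  rw [eventuallyConst_set']
  rcases eq_or_lt_of_le hc₀ with h₀ | h₀
  · left
    rw [ae_eq_empty]
    exact (measureReal_eq_zero_iff).1 h₀.symm
  · right
    have h₁ : c = 1 := by nlinarith
    rw [ae_eq_univ, prob_compl_eq_zero_iff hs]
    rw [hc, measureReal_def] at h₁
    rw [← ENNReal.ofReal_toReal (measure_ne_top μ s), h₁, ENNReal.ofReal_one]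

end MeanSquare

/-! ### Limits of means on a compact space -/

/-- An ultrafilter limit of normalised positive functionals on a compact space is the integral with
respect to a probability measure. -/
theorem exists_measure_of_means {X : Type*} [TopologicalSpace X] [CompactSpace X] [T2Space X]
    [MeasurableSpace X] [BorelSpace X] (Λ : ℕ → (X → ℝ) → ℝ)
    (hadd : ∀ n f g, Λ n (fun x => f x + g x) = Λ n f + Λ n g)
    (hmul : ∀ n c f, Λ n (fun x => c * f x) = c * Λ n f)
    (hmono : ∀ n f g, (∀ x, f x ≤ g x) → Λ n f ≤ Λ n g)
    (hone : ∀ n, Λ n (fun _ => 1) = 1) (U : Ultrafilter ℕ) :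
    ∃ μ : Measure X, IsProbabilityMeasure μ ∧
      ∀ f : C(X, ℝ), Tendsto (fun n => Λ n f) U (𝓝 (∫ x, f x ∂μ)) := by
  have hconst : ∀ n c, Λ n (fun _ => c) = c := fun n c => by
    have := hmul n c fun _ => 1
    simpa [hone] using this
  have hlim : ∀ f : C(X, ℝ), ∃ c, Tendsto (fun n => Λ n f) U (𝓝 c) := by
    intro f
    have hmem : ∀ n, Λ n f ∈ Set.Icc (-‖f‖) ‖f‖ := fun n =>
      ⟨(hconst n (-‖f‖)).symm.le.trans (hmono n _ _ fun x => f.neg_norm_le_apply x),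
        (hmono n _ _ fun x => f.apply_le_norm x).trans (hconst n ‖f‖).le⟩
    -- Bounded sequences converge along an ultrafilter, so the limit is automatically linear and
    -- positive in `f`.
    obtain ⟨c, -, hc⟩ := isCompact_Icc.ultrafilter_le_nhds' (U.map fun n => Λ n f)
      (Eventually.of_forall hmem : ∀ᶠ n in U, Λ n f ∈ Set.Icc (-‖f‖) ‖f‖)
    exact ⟨c, hc⟩
  choose L hL using hlim
  let Φ : CompactlySupportedContinuousMap X ℝ →ₚ[ℝ] ℝ :=
    { toFun := fun f => L f.toContinuousMap
      map_add' := fun f g => tendsto_nhds_unique (hL _)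
        (((hL f.toContinuousMap).add (hL g.toContinuousMap)).congr fun n => (hadd n _ _).symm)
      map_smul' := fun c f => tendsto_nhds_unique (hL _)
        (((hL f.toContinuousMap).const_mul c).congr fun n => (hmul n _ _).symm)
      monotone' := fun f g hfg => le_of_tendsto_of_tendsto' (hL f.toContinuousMap)
        (hL g.toContinuousMap) fun n => hmono n _ _ hfg }
  have hint : ∀ f : C(X, ℝ), ∫ x, f x ∂(RealRMK.rieszMeasure Φ) = L f := fun f =>
    RealRMK.integral_rieszMeasure Φ (CompactlySupportedContinuousMap.continuousMapEquiv f)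
  refine ⟨RealRMK.rieszMeasure Φ, ⟨?_⟩, fun f => hint f ▸ hL f⟩
  have h₁ : L 1 = 1 := tendsto_nhds_unique (hL 1) (tendsto_const_nhds.congr fun n => (hone n).symm)
  have h₂ := hint 1
  simp only [h₁, ContinuousMap.one_apply, integral_const, smul_eq_mul, mul_one] at h₂
  rw [measureReal_def] at h₂
  rw [← ENNReal.toReal_eq_one_iff, h₂]

/-! ### Cylinder sets -/

section Cylinder

variable {m : ℕ}

instance : BorelSpace (ℤ → Letter) := Pi.borelSpace

theorem continuous_hullShift : Continuous (hullShift m) := by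
  refine Continuous.subtype_mk (f := fun x : hull m => shift (x : ℤ → Letter)) ?_ _
  exact continuous_pi fun i => (continuous_apply (i + 1)).comp continuous_subtype_val

theorem continuous_hullShift_symm : Continuous (hullShift m).symm := by
  refine Continuous.subtype_mk (f := fun x : hull m => shift.symm (x : ℤ → Letter)) ?_ _
  exact continuous_pi fun i => (continuous_apply (i - 1)).comp continuous_subtype_val

theorem hullShift_apply (x : hull m) (i : ℤ) :
    (hullShift m x : ℤ → Letter) i = (x : ℤ → Letter) (i + 1) := rfl

theorem hullShift_iterate_apply (n : ℕ) (x : hull m) (i : ℤ) :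
    ((hullShift m)^[n] x : ℤ → Letter) i = (x : ℤ → Letter) (i + n) := by
  induction n generalizing x with
  | zero => simp
  | succ n ih =>
    rw [Function.iterate_succ_apply, ih, hullShift_apply]
    exact congrArg (x : ℤ → Letter) (by push_cast; ring)

theorem isClopen_cylinder {ℓ : ℕ} (k : ℤ) (w : Fin ℓ → Letter) : IsClopen (cylinder m k w) := by
  have h : cylinder m k w = ⋂ j : Fin ℓ, (fun x : hull m => (x : ℤ → Letter) (k + (j : ℕ))) ⁻¹'
      {w j} := by
    ext x
    simp [cylinder]
  rw [h]
  exact isClopen_iInter_of_finite fun j => (isClopen_discrete _).preimage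
    ((continuous_apply _).comp continuous_subtype_val)

theorem measurableSet_cylinder {ℓ : ℕ} (k : ℤ) (w : Fin ℓ → Letter) :
    MeasurableSet (cylinder m k w) := (isClopen_cylinder k w).isOpen.measurableSet

theorem preimage_hullShift_cylinder {ℓ : ℕ} (k : ℤ) (w : Fin ℓ → Letter) :
    hullShift m ⁻¹' cylinder m k w = cylinder m (k + 1) w := by
  ext x
  simp only [cylinder, Set.mem_preimage, Set.mem_ofPred_eq, hullShift_apply]
  refine forall_congr' fun j => ?_
  rw [add_right_comm]

theorem cylinder_eq_empty (hm : 1 ≤ m) {ℓ : ℕ} (k : ℤ) {w : Fin ℓ → Letter}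
    (hw : ¬IsLegal m (List.ofFn w)) : cylinder m k w = ∅ := by
  refine Set.eq_empty_of_forall_notMem fun x hx => hw ?_
  have := isLegal_of_mem_hull hm x.2 k ℓ
  rwa [show (fun j : Fin ℓ => (x : ℤ → Letter) (k + (j : ℕ))) = w from funext hx] at this

/-- The cylinder sets around the origin. -/
def centralCylinders (m : ℕ) : Set (Set (hull m)) :=
  {s | ∃ (n : ℕ) (w : Fin (2 * n + 1) → Letter), s = cylinder m (-n) w}

theorem mem_cylinder_central {n : ℕ} {w : Fin (2 * n + 1) → Letter} {x : hull m}
    (hx : x ∈ cylinder m (-n) w) (y : hull m) :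
    y ∈ cylinder m (-n) w ↔ ∀ i : ℤ, -n ≤ i → i ≤ n → (y : ℤ → Letter) i = (x : ℤ → Letter) i := by
  constructor
  · intro hy i h₁ h₂
    have h₃ : (-n : ℤ) + (i + n).toNat = i := by omega
    have hx' := hx ⟨(i + n).toNat, by omega⟩
    have hy' := hy ⟨(i + n).toNat, by omega⟩
    simp only [h₃] at hx' hy'
    rw [hx', hy']
  · intro h j
    rw [h _ (by omega) (by omega)]
    exact hx j

/-- Two central cylinders with a common point are nested. -/
theorem isPiSystem_centralCylinders : IsPiSystem (centralCylinders m) := by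
  rintro _ ⟨n, w, rfl⟩ _ ⟨n', w', rfl⟩ ⟨x, hx, hx'⟩
  rcases le_total n n' with h | h
  · refine ⟨n', w', Set.inter_eq_right.2 fun y hy => ?_⟩
    rw [mem_cylinder_central hx'] at hy
    exact (mem_cylinder_central hx y).2 fun i h₁ h₂ => hy i (by omega) (by omega)
  · refine ⟨n, w, Set.inter_eq_left.2 fun y hy => ?_⟩
    rw [mem_cylinder_central hx] at hy
    exact (mem_cylinder_central hx' y).2 fun i h₁ h₂ => hy i (by omega) (by omega)

theorem generateFrom_centralCylinders :
    (inferInstance : MeasurableSpace (hull m)) =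
      MeasurableSpace.generateFrom (centralCylinders m) := by
  apply le_antisymm
  · have : @Measurable (hull m) (ℤ → Letter) (MeasurableSpace.generateFrom (centralCylinders m)) _
        Subtype.val := by
      refine @measurable_pi_lambda _ _ _ (MeasurableSpace.generateFrom (centralCylinders m)) _ _
        fun i => ?_
      refine @measurable_to_countable' _ _ _ _ (MeasurableSpace.generateFrom (centralCylinders m)) _
        fun l => ?_
      have hl : (fun x : hull m => (x : ℤ → Letter) i) ⁻¹' {l} =
          ⋃ w : {w : Fin (2 * i.natAbs + 1) → Letter //
            w ⟨(i + i.natAbs).toNat, by omega⟩ = l}, cylinder m (-i.natAbs) w.1 := by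
        have h₃ : (-(i.natAbs : ℤ)) + (i + i.natAbs).toNat = i := by omega
        ext x
        simp only [Set.mem_preimage, Set.mem_singleton_iff, Set.mem_iUnion]
        constructor
        · intro hx
          exact ⟨⟨fun j => (x : ℤ → Letter) (-i.natAbs + (j : ℕ)), by simp only [h₃, hx]⟩,
            fun j => rfl⟩
        · rintro ⟨⟨w, hw⟩, hx⟩
          have := hx ⟨(i + i.natAbs).toNat, by omega⟩
          simp only [h₃] at this
          rw [this, hw]
      rw [hl]
      exact MeasurableSet.iUnion fun w => MeasurableSpace.measurableSet_generateFrom ⟨_, _, rfl⟩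
    exact measurable_iff_comap_le.1 this
  · refine MeasurableSpace.generateFrom_le ?_
    rintro _ ⟨n, w, rfl⟩
    exact measurableSet_cylinder _ _

/-- A probability measure is determined by the measures of the cylinder sets. -/
theorem ext_of_cylinder {μ ν : Measure (hull m)} [IsProbabilityMeasure μ] [IsProbabilityMeasure ν]
    (h : ∀ (ℓ : ℕ), 1 ≤ ℓ → ∀ (k : ℤ) (w : Fin ℓ → Letter),
      μ (cylinder m k w) = ν (cylinder m k w)) : μ = ν := by
  refine ext_of_generate_finite _ generateFrom_centralCylinders isPiSystem_centralCylinders ?_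
    (by simp)
  rintro _ ⟨n, w, rfl⟩
  exact h _ (by omega) _ _

/-- The number of visits to a cylinder set is about the number of occurrences of its word. -/
theorem abs_birkhoffSum_sub_occ_le {ℓ : ℕ} (w : Fin ℓ → Letter) (x : hull m) {v : List Letter}
    (hv : ∀ j : ℕ, j < v.length → v[j]? = some ((x : ℤ → Letter) j)) :
    |birkhoffSum (hullShift m) ((cylinder m 0 w).indicator fun _ => (1 : ℝ)) v.length x -
      occ (List.ofFn w) v| ≤ ℓ := by
  rw [occ, tailSum_eq_sum_range, birkhoffSum, ← Finset.sum_sub_distrib]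
  -- A visit at time `i` is an occurrence at position `i` unless the word would run beyond the end
  -- of `v`.
  have hterm : ∀ i ∈ Finset.range v.length,
      |(cylinder m 0 w).indicator (fun _ => (1 : ℝ)) ((hullShift m)^[i] x) -
        prefixInd (List.ofFn w) (v.drop i)| ≤ if v.length < i + ℓ then 1 else 0 := by
    intro i hi
    split_ifs with h
    · have h₁ := prefixInd_nonneg (List.ofFn w) (v.drop i)
      have h₂ := prefixInd_le_one (List.ofFn w) (v.drop i)
      rw [abs_le]
      by_cases hx : (hullShift m)^[i] x ∈ cylinder m 0 w
      · rw [Set.indicator_of_mem hx]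
        constructor <;> linarith
      · rw [Set.indicator_of_notMem hx]
        constructor <;> linarith
    · have hiff : (hullShift m)^[i] x ∈ cylinder m 0 w ↔ List.ofFn w <+: v.drop i := by
        rw [List.prefix_iff_getElem?]
        simp only [cylinder, Set.mem_ofPred_eq, hullShift_iterate_apply, List.length_ofFn]
        constructor
        · intro hx j hj
          rw [List.getElem?_drop, hv _ (by omega), List.getElem_ofFn, ← hx ⟨j, hj⟩]
          exact congrArg (fun k => some ((x : ℤ → Letter) k)) (by push_cast; ring)
        · intro hx j
          have := hx j j.2
          rw [List.getElem?_drop, hv _ (by omega), List.getElem_ofFn] at this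
          rw [← Option.some.inj this]
          exact congrArg (x : ℤ → Letter) (by push_cast; ring)
      by_cases hx : (hullShift m)^[i] x ∈ cylinder m 0 w
      · rw [Set.indicator_of_mem hx, prefixInd, if_pos (hiff.1 hx)]
        simp
      · rw [Set.indicator_of_notMem hx, prefixInd, if_neg fun h => hx (hiff.2 h)]
        simp
  refine (Finset.abs_sum_le_sum_abs _ _).trans ((Finset.sum_le_sum hterm).trans ?_)
  rw [Finset.sum_boole]
  have : (Finset.range v.length).filter (fun i => v.length < i + ℓ) ⊆
      Finset.Ico (v.length - ℓ) v.length := by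
    intro i hi
    simp only [Finset.mem_filter, Finset.mem_range, Finset.mem_Ico] at hi ⊢
    omega
  have h := Finset.card_le_card this
  rw [Nat.card_Ico] at h
  exact_mod_cast h.trans (by omega)

end Cylinder

/-! ### The measure -/

section Measure

variable {m : ℕ} {p : Fin (m + 1) → ℝ}

/-- Lets finite words be tested against functions on the hull; the value at illegal words is
arbitrary. -/
theorem exists_hull_point (hm : 1 ≤ m) : ∃ pt : List Letter → hull m, ∀ v, IsLegal m v →
    ∀ j : ℕ, j < v.length → v[j]? = some ((pt v : ℤ → Letter) j) := by
  obtain ⟨x₀, hx₀, -⟩ := (isLegal_aa hm).exists_mem_hull hm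
  have : ∀ v, ∃ x : hull m, IsLegal m v →
      ∀ j : ℕ, j < v.length → v[j]? = some ((x : ℤ → Letter) j) := by
    intro v
    by_cases hv : IsLegal m v
    · obtain ⟨x, hx, h⟩ := hv.exists_mem_hull hm
      exact ⟨⟨x, hx⟩, fun _ => h⟩
    · exact ⟨⟨x₀, hx₀⟩, fun h => absurd h hv⟩
  exact ⟨fun v => (this v).choose, fun v => (this v).choose_spec⟩

/-- There is a shift-invariant probability measure on the hull that gives the cylinder sets the
frequencies of their words. -/
theorem exists_invariant_measure (hm : 1 ≤ m) (P : IsPosProb p) :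
    ∃ μ : Measure (hull m), IsProbabilityMeasure μ ∧ MeasurePreserving (hullShift m) μ μ ∧
      ∀ (ℓ : ℕ) (w : Fin ℓ → Letter), μ.real (cylinder m 0 w) = freq p (List.ofFn w) := by
  obtain ⟨pt, hpt⟩ := exists_hull_point hm
  set S := hullShift m
  set Λ : ℕ → (hull m → ℝ) → ℝ := fun n f =>
    (expect p)^[n] (fun v => birkhoffSum S f v.length (pt v)) [Letter.a] / imageLen m n Letter.a
    with hΛ
  have hpos : ∀ n, (0 : ℝ) < imageLen m n Letter.a := fun n => by exact_mod_cast imageLen_pos n _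
  have herr : ∀ C : ℝ, Tendsto (fun n => C / (imageLen m n Letter.a : ℝ)) atTop (𝓝 0) :=
    fun C => (tendsto_imageLen_atTop hm).const_div_atTop C
  have hbound : ∀ (n : ℕ) (g g' : List Letter → ℝ) (C : ℝ),
      (∀ v, IsIterImage m n [Letter.a] v → |g v - g' v| ≤ C) →
        dist ((expect p)^[n] g [Letter.a] / imageLen m n Letter.a)
          ((expect p)^[n] g' [Letter.a] / imageLen m n Letter.a) ≤
            C / (imageLen m n Letter.a : ℝ) := by
    intro n g g' C h
    rw [Real.dist_eq, ← sub_div, abs_div, abs_of_pos (hpos n), ← iterate_expect_sub P]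
    gcongr
    rw [abs_le]
    constructor
    · rw [← iterate_expect_const P n [Letter.a] (-C)]
      exact iterate_expect_mono P fun v hv => (abs_le.1 (h v hv)).1
    · exact iterate_expect_le_const P fun v hv => (abs_le.1 (h v hv)).2
  obtain ⟨μ, hμ, hlim⟩ := exists_measure_of_means Λ
    (fun n f g => by
      simp only [hΛ, birkhoffSum, Finset.sum_add_distrib, iterate_expect_add P, add_div])
    (fun n c f => by
      simp only [hΛ, birkhoffSum, ← Finset.mul_sum, iterate_expect_const_mul P, mul_div_assoc])
    (fun n f g hfg => by
      simp only [hΛ]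
      gcongr
      exact iterate_expect_mono P fun v _ => Finset.sum_le_sum fun i _ => hfg _)
    (fun n => by
      simp only [hΛ]
      rw [iterate_expect_eq_const P (c := (imageLen m n Letter.a : ℝ))]
      · exact div_self (hpos n).ne'
      · intro v hv
        simp [birkhoffSum, hv.length_eq]) (Ultrafilter.of atTop)
  have hU : (Ultrafilter.of (atTop : Filter ℕ) : Filter ℕ) ≤ atTop := Ultrafilter.of_le _
  refine ⟨μ, hμ, ⟨continuous_hullShift.measurable, ?_⟩, fun ℓ w => ?_⟩
  · have : IsProbabilityMeasure (μ.map S) :=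
      Measure.isProbabilityMeasure_map continuous_hullShift.measurable.aemeasurable
    refine ext_of_forall_integral_eq_of_IsFiniteMeasure fun f => ?_
    rw [integral_map continuous_hullShift.measurable.aemeasurable
      f.continuous.aestronglyMeasurable]
    have h₁ := hlim (f.toContinuousMap.comp ⟨S, continuous_hullShift⟩)
    have h₂ := hlim f.toContinuousMap
    refine tendsto_nhds_unique h₁ (h₂.congr_dist (squeeze_zero (fun _ => dist_nonneg) (fun n => ?_)
      ((herr (2 * ‖f‖)).mono_left hU)))
    refine hbound n _ _ _ fun v _ => ?_
    -- Telescoping: the shift changes the sum by two boundary terms, which vanish after division by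
    -- the length.
    have h₃ : ∀ N x, birkhoffSum S (fun y => f (S y)) N x - birkhoffSum S f N x =
        f (S^[N] x) - f x := by
      intro N x
      rw [← birkhoffSum_apply_sub_birkhoffSum]
      congr 1
      simp only [birkhoffSum, ← Function.iterate_succ_apply', Function.iterate_succ_apply]
    rw [abs_sub_comm]
    refine (congrArg abs (h₃ _ _)).le.trans ((abs_sub _ _).trans ?_)
    have h₄ := f.norm_coe_le_norm (S^[v.length] (pt v))
    have h₅ := f.norm_coe_le_norm (pt v)
    rw [Real.norm_eq_abs] at h₄ h₅
    linarith
  -- Cylinders are clopen, so the limit of the means applies to their indicators, and there it is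
  -- the frequency.
  · let F : C(hull m, ℝ) := ⟨(cylinder m 0 w).indicator fun _ => (1 : ℝ),
      continuous_const.indicator fun x hx => by
        rw [(isClopen_cylinder 0 w).frontier_eq] at hx
        exact absurd hx (Set.notMem_empty x)⟩
    have h₁ : Tendsto (fun n => Λ n F) atTop (𝓝 (freq p (List.ofFn w))) := by
      refine (tendsto_freq hm P (List.ofFn w)).congr_dist
        (squeeze_zero (fun _ => dist_nonneg) (fun n => ?_) (herr ℓ))
      refine hbound n _ _ _ fun v hv => ?_
      rw [abs_sub_comm]
      exact abs_birkhoffSum_sub_occ_le w (pt v) (hpt v hv.isLegal)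
    have h₂ := tendsto_nhds_unique (hlim F) (h₁.mono_left hU)
    rw [← h₂, ← integral_indicator_one (measurableSet_cylinder 0 w)]
    rfl

variable {μ : Measure (hull m)}

theorem measure_cylinder_eq (hμ : MeasurePreserving (hullShift m) μ μ) {ℓ : ℕ} (k : ℤ)
    (w : Fin ℓ → Letter) : μ (cylinder m k w) = μ (cylinder m 0 w) := by
  have hstep : ∀ k : ℤ, μ (cylinder m (k + 1) w) = μ (cylinder m k w) := fun k => by
    rw [← preimage_hullShift_cylinder,
      hμ.measure_preimage (measurableSet_cylinder k w).nullMeasurableSet]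
  induction k using Int.induction_on with
  | zero => rfl
  | succ i ih => rw [hstep, ih]
  | pred i ih => rw [← ih, ← hstep, sub_add_cancel]

theorem integral_window [IsProbabilityMeasure μ] (hm : 1 ≤ m)
    (hcyl : ∀ (ℓ : ℕ) (w : Fin ℓ → Letter), μ.real (cylinder m 0 w) = freq p (List.ofFn w))
    (N : ℕ) (φ : List Letter → ℝ) :
    Integrable (fun x : hull m => φ (List.ofFn fun j : Fin N => (x : ℤ → Letter) (j : ℕ))) μ ∧
      ∫ x : hull m, φ (List.ofFn fun j : Fin N => (x : ℤ → Letter) (j : ℕ)) ∂μ =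
        ∑ w : LegalWord m N, φ (List.ofFn w.1) * freq p (List.ofFn w.1) := by
  have h : (fun x : hull m => φ (List.ofFn fun j : Fin N => (x : ℤ → Letter) (j : ℕ))) =
      fun x => ∑ w : LegalWord m N,
        φ (List.ofFn w.1) * (cylinder m 0 w.1).indicator (fun _ => (1 : ℝ)) x := by
    funext x
    have hx := isLegal_of_mem_hull hm x.2 0 N
    simp only [zero_add] at hx
    rw [Finset.sum_eq_single (⟨fun j : Fin N => (x : ℤ → Letter) (j : ℕ), hx⟩ : LegalWord m N)]
    · rw [Set.indicator_of_mem, mul_one]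
      intro j
      rw [zero_add]
    · intro w _ hw
      rw [Set.indicator_of_notMem, mul_zero]
      refine fun hxw => hw (Subtype.ext (funext fun j => ?_))
      rw [← hxw j, zero_add]
    · simp
  have hint : ∀ w : LegalWord m N, Integrable (fun x =>
      φ (List.ofFn w.1) * (cylinder m 0 w.1).indicator (fun _ => (1 : ℝ)) x) μ := fun w =>
    ((integrable_const 1).indicator (measurableSet_cylinder 0 w.1)).const_mul _
  refine ⟨h ▸ integrable_finsetSum _ fun w _ => hint w, ?_⟩
  rw [h, integral_finsetSum _ fun w _ => hint w]
  refine Finset.sum_congr rfl fun w _ => ?_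
  rw [integral_const_mul, integral_indicator_const _ (measurableSet_cylinder 0 w.1), hcyl]
  simp

/-- Visits before time `N` are occurrences in the window `[0, N)` up to `ℓ`, and `exists_sum_sq_le`
bounds their mean square deviation. -/
theorem hasMeanFreq_cylinder_zero [IsProbabilityMeasure μ] (hm : 1 ≤ m) (P : IsPosProb p)
    (hcyl : ∀ (ℓ : ℕ) (w : Fin ℓ → Letter), μ.real (cylinder m 0 w) = freq p (List.ofFn w))
    {ℓ : ℕ} (w : Fin ℓ → Letter) : HasMeanFreq μ (hullShift m) (cylinder m 0 w) := by
  intro ε hε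
  obtain ⟨W₀, hW₀⟩ := exists_sum_sq_le hm P (List.ofFn w) (show 0 < ε / 4 by positivity)
  obtain ⟨N₁, hN₁⟩ := exists_nat_ge (4 / ε * (ℓ : ℝ) ^ 2)
  refine ⟨max W₀ (max 1 N₁), fun N hN => ?_⟩
  simp only [max_le_iff] at hN
  set u := List.ofFn w with hu
  obtain ⟨hint, hval⟩ := integral_window (p := p) hm hcyl N fun v => (occ u v - freq p u * N) ^ 2
  calc _ ≤ ∫ x : hull m, (2 * (occ u (List.ofFn fun j : Fin N => (x : ℤ → Letter) (j : ℕ)) -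
        freq p u * N) ^ 2 + 2 * (ℓ : ℝ) ^ 2) ∂μ := by
        refine integral_mono (integrable_visitDev_sq continuous_hullShift.measurable
          (measurableSet_cylinder 0 w) N) ((hint.const_mul 2).add (integrable_const _)) fun x => ?_
        have h := abs_birkhoffSum_sub_occ_le w x
          (v := List.ofFn fun j : Fin N => (x : ℤ → Letter) (j : ℕ)) fun j hj => by
            simp only [List.length_ofFn] at hj
            simp [hj]
        rw [List.length_ofFn] at h
        have h' := sq_le_sq' (abs_le.1 h).1 (abs_le.1 h).2
        simp only [visitDev, hcyl, ← hu] at h' ⊢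
        set A := birkhoffSum (hullShift m) ((cylinder m 0 w).indicator fun _ => (1 : ℝ)) N x
        set B := occ u (List.ofFn fun j : Fin N => (x : ℤ → Letter) (j : ℕ))
        nlinarith [sq_nonneg (A - B - (B - freq p u * N))]
    _ ≤ 2 * (ε / 4 * (N : ℝ) ^ 2) + 2 * (ℓ : ℝ) ^ 2 := by
        rw [integral_add (hint.const_mul 2) (integrable_const _), integral_const_mul, hval]
        have := hW₀ N hN.1
        simp only [integral_const, probReal_univ, one_smul]
        linarith
    _ ≤ ε * (N : ℝ) ^ 2 := by
        have h₁ : (1 : ℝ) ≤ N := by exact_mod_cast hN.2.1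
        have h₂ : 4 / ε * (ℓ : ℝ) ^ 2 ≤ N := hN₁.trans (by exact_mod_cast hN.2.2)
        rw [div_mul_eq_mul_div, div_le_iff₀ hε] at h₂
        nlinarith [mul_le_mul_of_nonneg_left h₁ (by positivity : 0 ≤ ε * (N : ℝ))]

theorem hasMeanFreq_cylinder [IsProbabilityMeasure μ] (hm : 1 ≤ m) (P : IsPosProb p)
    (hμ : MeasurePreserving (hullShift m) μ μ)
    (hcyl : ∀ (ℓ : ℕ) (w : Fin ℓ → Letter), μ.real (cylinder m 0 w) = freq p (List.ofFn w))
    {ℓ : ℕ} (k : ℤ) (w : Fin ℓ → Letter) : HasMeanFreq μ (hullShift m) (cylinder m k w) := by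
  have hstep : ∀ (k : ℤ) (N : ℕ), ∫ x, visitDev μ (hullShift m) (cylinder m (k + 1) w) N x ^ 2 ∂μ =
      ∫ x, visitDev μ (hullShift m) (cylinder m k w) N x ^ 2 ∂μ := by
    intro k N
    have h₁ : ∀ x, visitDev μ (hullShift m) (cylinder m (k + 1) w) N x =
        visitDev μ (hullShift m) (cylinder m k w) N (hullShift m x) := by
      intro x
      have hreal : μ.real (cylinder m (k + 1) w) = μ.real (cylinder m k w) := by
        simp only [measureReal_def, measure_cylinder_eq hμ]
      rw [visitDev, visitDev, hreal]
      congr 1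
      refine Finset.sum_congr rfl fun i _ => ?_
      rw [← Function.iterate_succ_apply, Function.iterate_succ_apply',
        ← preimage_hullShift_cylinder k w]
      rfl
    have hmeas := integrable_visitDev_sq (μ := μ) hμ.measurable (measurableSet_cylinder k w) N
    have := integral_map (μ := μ) hμ.measurable.aemeasurable
      (f := fun x => visitDev μ (hullShift m) (cylinder m k w) N x ^ 2)
      (by rw [hμ.map_eq]; exact hmeas.1)
    rw [hμ.map_eq] at this
    simp only [h₁, this]
  have hzero := hasMeanFreq_cylinder_zero hm P hcyl w
  induction k using Int.induction_on with
  | zero => exact hzero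
  | succ i ih => simpa only [HasMeanFreq, hstep] using ih
  | pred i ih =>
    simp only [HasMeanFreq] at ih ⊢
    simpa only [← hstep (-(i : ℤ) - 1), sub_add_cancel] using ih

end Measure

end RNMS

end

/-! ### The main theorem. -/

open RNMS

theorem theorem1 (m : ℕ) (hm : 1 ≤ m) (p : Fin (m + 1) → ℝ) (hp : ∀ i, 0 < p i)
    (hp_sum : ∑ i, p i = 1) :
    ∃ μ : Measure (RNMS.hull m),
      RNMS.HasPFCylinders m p μ ∧
      (∀ ν : Measure (RNMS.hull m), RNMS.HasPFCylinders m p ν → ν = μ) ∧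
      IsProbabilityMeasure μ ∧
      MeasurePreserving (RNMS.hullShift m) μ μ ∧
      (∀ f : RNMS.hull m → ℂ, Integrable f μ → ∀ s : ℤ, ∀ᵐ x ∂μ,
        Tendsto
          (fun N : ℕ => (1 / (N : ℂ)) *
            ∑ i ∈ Finset.Icc s ((N : ℤ) + s - 1), f ((RNMS.hullShift m ^ i) x))
          atTop (𝓝 (∫ y, f y ∂μ))) ∧
      Ergodic (RNMS.hullShift m) μ := by
  have P : IsPosProb p := ⟨hp, hp_sum⟩
  obtain ⟨μ, hprob, hinv, hcyl⟩ := exists_invariant_measure hm P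
  have hval : ∀ (ℓ : ℕ) (k : ℤ) (w : Fin ℓ → Letter),
      μ (cylinder m k w) = ENNReal.ofReal (freq p (List.ofFn w)) := fun ℓ k w => by
    rw [measure_cylinder_eq hinv, ← hcyl, ofReal_measureReal]
  have herg : Ergodic (hullShift m) μ := by
    refine ergodic_of_hasMeanFreq hinv generateFrom_centralCylinders isPiSystem_centralCylinders ?_
    rintro _ ⟨n, w, rfl⟩
    exact hasMeanFreq_cylinder hm P hinv hcyl _ w
  refine ⟨μ, fun ℓ hℓ => ⟨_, isRightPF_freq hm P hℓ, fun k w => hval ℓ k w.1⟩, fun ν hν => ?_,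
    hprob, hinv, fun f hf s => ae_tendsto_average_Icc herg
      continuous_hullShift_symm.measurable hf s, herg⟩
  have hνval : ∀ (ℓ : ℕ), 1 ≤ ℓ → ∀ (k : ℤ) (w : Fin ℓ → Letter),
      ν (cylinder m k w) = μ (cylinder m k w) := by
    intro ℓ hℓ k w
    by_cases hw : IsLegal m (List.ofFn w)
    · obtain ⟨R, hR, hνR⟩ := hν ℓ hℓ
      rw [hνR k ⟨w, hw⟩, hR.eq_freq hm P hℓ, hval]
    · simp [cylinder_eq_empty hm k hw]
  -- The cylinder condition does not presuppose total mass one; it follows from the partition into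
  -- length-one cylinders.
  have hνprob : IsProbabilityMeasure ν := by
    have hunion : (Set.univ : Set (hull m)) = ⋃ l : Letter, cylinder m 0 (fun _ : Fin 1 => l) := by
      ext x
      simp only [Set.mem_univ, Set.mem_iUnion, true_iff]
      exact ⟨(x : ℤ → Letter) 0, fun j => by simp⟩
    have hdisj : Pairwise (Function.onFun Disjoint
        fun l : Letter => cylinder m 0 (fun _ : Fin 1 => l)) := by
      intro l l' hne
      refine Set.disjoint_left.2 fun x hx hx' => hne ?_
      exact (hx 0).symm.trans (hx' 0)
    have hmeas := fun l : Letter => measurableSet_cylinder (m := m) 0 (fun _ : Fin 1 => l)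
    refine ⟨?_⟩
    rw [hunion, measure_iUnion hdisj hmeas]
    simp only [hνval 1 le_rfl]
    rw [← measure_iUnion hdisj hmeas, ← hunion, measure_univ]
  exact ext_of_cylinder hνval
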